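/- \textbf{Conventions.} A quadratic form in $n$ variables is identified with its real symmetric $n\times n$ matrix $f$, and $f[x]=x^{T}fx$. Forms $f,g$ are (integrally) equivalent, $f\sim g$, if $f=U^{T}gU$ with $U\in GL(n,\mathbb{Z})$. The arithmetic minimum of a positive definite $f$ is $\min\{f[v]: v\in\mathbb{Z}^n\setminus\{0\}\}$; the vectors attaining it are its minimal vectors ($v$ and $-v$ are both counted). A positive definite form $f$ with arithmetic minimum $m$ is perfect if it is the only symmetric matrix $A$ with $A[v]=m$ for all minimal vectors $v$ of $f$; its perfect domain is the convex cone generated by the matrices $vv^{T}$, $v$ a minimal vector of $f$. A wall of a cone is a face of codimension one in it; a common wall of two cones is a wall of both which equals their intersection. A finite set $V\subset\mathbb{Z}^n$ is (the vertex set of) a Delaunay cell of $\mathbb{Z}^n$ for a positive definite $f$ if $V$ affinely spans $\mathbb{R}^n$ and there are $c\in\mathbb{R}^n$, $r\in\mathbb{R}$ with $f[x-c]\ge r$ for all $x\in\mathbb{Z}^n$ and equality exactly for $x\in V$. Let $R_n\subset\mathbb{Z}^n$ be the set consisting of $0$, the standard basis vectors $e_1,\dots,e_n$, and $(1,\dots,1,-(n-3))$.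 Let $TW(n)$ be the convex cone generated by the matrices $vv^{T}$, where $v$ runs over all $v\in\mathbb{Z}^n$ with $v\cdot x\in\{0,1\}$ for all $x\in R_n$. Let $D_n$ denote the form of the root lattice $D_n$ scaled to arithmetic minimum $1$ (half the Cartan matrix of type $D_n$). Let $TF_n=(a_{ij})$ be the symmetric matrix with $a_{ii}=1$ for $i<n$ and, for even $n$, $$a_{nn}=\tfrac12 n^2-\tfrac72 n+7,\qquad a_{ij}=\frac{n-4}{2(n-2)}\ (i\ne j;\ i,j<n),\qquad a_{in}=-\frac{n^2-6n+10}{2(n-2)}\ (i<n),$$ and for odd $n$, $$a_{nn}=\frac{n^3-8n^2+23n-20}{2(n-1)},\qquad a_{ij}=\frac{n-3}{2(n-1)}\ (i\ne j;\ i,j<n),\qquad a_{in}=-\frac{n^2-5n+8}{2(n-1)}\ (i<n).$$ \textbf{Theorem (Perfect Domain Description).} Let $n>4$. (1) $TW(n)$ has codimension one in the space of quadratic forms, i.e. dimension $\frac{n(n+1)}2-1$, and its relative interior is the set of all positive definite forms for which $R_n$ is a Delaunay cell of $\mathbb{Z}^n$. (2) $TF_n$ is a perfect form with arithmetic minimum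 $1$. It has exactly $n(n+3)$ minimal vectors if $n$ is even and exactly $n(n+1)$ if $n$ is odd. (3) There is a perfect form $g\sim D_n$ such that $TW(n)$ is a common wall of the perfect domains of $g$ and of $TF_n$. Moreover, $TF_5\sim\varphi_2^5$ and $TF_6\sim E_6^{*}$. Here $\varphi_2^5$ is the third perfect form in five variables of Korkine and Zolotareff, that is, the form of Coxeter's lattice $A_5^{3}$ (generated by the root lattice $A_5$ and its glue vector $(\frac13,\frac13,\frac13,\frac13,-\frac23,-\frac23)$) scaled to arithmetic minimum $1$, and $E_6^{*}$ is the form of the dual of the root lattice $E_6$ scaled to arithmetic minimum $1$. -/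

import Mathlib

open scoped Matrix

/-- The value `f[x] = xᵀ f x` of the quadratic form with symmetric matrix `f`. -/
def quadValue {n : ℕ} (f : Matrix (Fin n) (Fin n) ℝ) (x : Fin n → ℝ) : ℝ :=
  x ⬝ᵥ (f *ᵥ x)

/-- An integral vector seen as a real vector. -/
def toReal {n : ℕ} (v : Fin n → ℤ) : Fin n → ℝ := fun i => (v i : ℝ)

/-- `m` is the arithmetic minimum of `f`: the minimum on the nonzero integral vectors. -/
def IsArithmeticMinimum {n : ℕ} (f : Matrix (Fin n) (Fin n) ℝ) (m : ℝ) : Prop :=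
  IsLeast {y : ℝ | ∃ v : Fin n → ℤ, v ≠ 0 ∧ quadValue f (toReal v) = y} m

/-- The minimal vectors of `f`: the nonzero integral vectors at which the minimum is attained
(both `v` and `-v` are listed). -/
def minimalVectors {n : ℕ} (f : Matrix (Fin n) (Fin n) ℝ) : Set (Fin n → ℤ) :=
  {v | v ≠ 0 ∧ ∀ w : Fin n → ℤ, w ≠ 0 → quadValue f (toReal v) ≤ quadValue f (toReal w)}

/-- A perfect form: a positive definite form which is the only symmetric matrix that takes the
value `m` (the arithmetic minimum of the form) at all its minimal vectors. -/
def IsPerfectForm {n : ℕ} (f : Matrix (Fin n) (Fin n) ℝ) : Prop :=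
  f.PosDef ∧ ∀ m : ℝ, IsArithmeticMinimum f m →
    ∀ A : Matrix (Fin n) (Fin n) ℝ, A.IsSymm →
      (∀ v ∈ minimalVectors f, quadValue A (toReal v) = m) → A = f

/-- Integral equivalence, i.e. `GL(n, ℤ)`-equivalence, of quadratic forms. -/
def IntegrallyEquivalent {n : ℕ} (f g : Matrix (Fin n) (Fin n) ℝ) : Prop :=
  ∃ U : Matrix (Fin n) (Fin n) ℤ, IsUnit U.det ∧
    f = (U.map (Int.cast : ℤ → ℝ))ᵀ * g * U.map (Int.cast : ℤ → ℝ)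

/-- The rank one form `x ↦ (v • x)²` (Voronoi image of the integral vector `v`). -/
def voronoiImage {n : ℕ} (v : Fin n → ℤ) : Matrix (Fin n) (Fin n) ℝ :=
  Matrix.vecMulVec (toReal v) (toReal v)

/-- The convex cone generated by the Voronoi images of the vectors of a set. -/
def voronoiCone {n : ℕ} (V : Set (Fin n → ℤ)) : PointedCone ℝ (Matrix (Fin n) (Fin n) ℝ) :=
  PointedCone.hull ℝ (voronoiImage '' V)

/-- The (closed) perfect domain of a form. -/
def perfectDomain {n : ℕ} (f : Matrix (Fin n) (Fin n) ℝ) :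
    PointedCone ℝ (Matrix (Fin n) (Fin n) ℝ) :=
  voronoiCone (minimalVectors f)

/-- The dimension of a cone, i.e. of its linear span. -/
noncomputable def coneDim {n : ℕ} (C : PointedCone ℝ (Matrix (Fin n) (Fin n) ℝ)) : ℕ :=
  Module.finrank ℝ (Submodule.span ℝ (C : Set (Matrix (Fin n) (Fin n) ℝ)))

/-- `W` is a wall of `D`: a face of codimension one. -/
def IsWall {n : ℕ} (W D : PointedCone ℝ (Matrix (Fin n) (Fin n) ℝ)) : Prop :=
  W.IsFaceOf D ∧ coneDim W + 1 = coneDim D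

/-- `W` is a common wall of `D₁` and `D₂`: a wall of both, and the domains meet exactly
along it. -/
def IsCommonWall {n : ℕ} (W D₁ D₂ : PointedCone ℝ (Matrix (Fin n) (Fin n) ℝ)) : Prop :=
  IsWall W D₁ ∧ IsWall W D₂ ∧ D₁ ⊓ D₂ = W

/-- `V` is the set of lattice points (equivalently, of vertices) of an `n`-dimensional cell of
the Delaunay tiling of `ℤⁿ` with respect to the positive definite form `f`: the ellipsoid
`f[x - c] = r` has no integral point inside, passes through exactly the integral points of `V`,
and `V` affinely spans the space. -/
def IsDelaunayCell {n : ℕ} (f : Matrix (Fin n) (Fin n) ℝ) (V : Set (Fin n → ℤ)) : Prop :=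
  ∃ (c : Fin n → ℝ) (r : ℝ),
    (∀ x : Fin n → ℤ, r ≤ quadValue f (toReal x - c)) ∧
    V = {x : Fin n → ℤ | quadValue f (toReal x - c) = r} ∧
    affineSpan ℝ (toReal '' V) = ⊤

/-- The `(0,1)`-dual of a set of integral vectors. -/
def zeroOneDual {n : ℕ} (S : Set (Fin n → ℤ)) : Set (Fin n → ℤ) :=
  {w | ∀ v ∈ S, w ⬝ᵥ v = 0 ∨ w ⬝ᵥ v = 1}

/-- The vertices of the big simplex `Sₙ`: the origin, the first `n - 1` basis vectors, and the
vector `(1, …, 1, -(n - 3))`. -/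
def bigSimplex (n : ℕ) : Set (Fin n → ℤ) :=
  {v | v = 0 ∨ (∃ i : Fin n, (i : ℕ) + 1 < n ∧ v = Pi.single i 1) ∨
    v = fun i : Fin n => if (i : ℕ) + 1 < n then 1 else -((n : ℤ) - 3)}

/-- The repartitioning complex `Rₙ`: the vertices of `Sₙ` and the last basis vector. -/
def repartitioningComplex (n : ℕ) : Set (Fin n → ℤ) :=
  bigSimplex n ∪ {v | v = fun i : Fin n => if (i : ℕ) + 1 < n then 0 else 1}

/-- The cone `TW(n)`, generated by the Voronoi images of the `(0,1)`-dual of `Rₙ`. -/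
def tameWall (n : ℕ) : PointedCone ℝ (Matrix (Fin n) (Fin n) ℝ) :=
  voronoiCone (zeroOneDual (repartitioningComplex n))

/-- The second perfect form `Dₙ`, scaled to arithmetic minimum `1`: half the Gram matrix of the
simple roots of the root lattice `Dₙ`. -/
noncomputable def formD (n : ℕ) : Matrix (Fin n) (Fin n) ℝ :=
  (1 / 2 : ℝ) • (CartanMatrix.D n).map (Int.cast : ℤ → ℝ)

/-- The form `TFₙ`. -/
noncomputable def formTF (n : ℕ) : Matrix (Fin n) (Fin n) ℝ :=
  Matrix.of fun i j =>
    if (i : ℕ) + 1 < n ∧ (j : ℕ) + 1 < n then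
      if i = j then 1
      else if Even n then ((n : ℝ) - 4) / (2 * ((n : ℝ) - 2))
      else ((n : ℝ) - 3) / (2 * ((n : ℝ) - 1))
    else if i = j then
      if Even n then (1 / 2) * (n : ℝ) ^ 2 - (7 / 2) * (n : ℝ) + 7
      else ((n : ℝ) ^ 3 - 8 * (n : ℝ) ^ 2 + 23 * (n : ℝ) - 20) / (2 * ((n : ℝ) - 1))
    else
      if Even n then -(((n : ℝ) ^ 2 - 6 * (n : ℝ) + 10) / (2 * ((n : ℝ) - 2)))
      else -(((n : ℝ) ^ 2 - 5 * (n : ℝ) + 8) / (2 * ((n : ℝ) - 1)))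

/-- A basis (the rows) of three times Coxeter's lattice `A₅³`; the minimal norm is `12`. -/
def basisA53 : Matrix (Fin 5) (Fin 6) ℤ :=
  !![1, 1, 1, 1, -2, -2;
     0, 3, -3, 0, 0, 0;
     0, 0, 3, -3, 0, 0;
     0, 0, 0, 3, -3, 0;
     0, 0, 0, 0, 3, -3]

/-- The rows of `basisA53` generate the lattice of all integral vectors with coordinate sum `0`
and all coordinates congruent modulo `3`. This is `3` times the lattice `A₅³`, which is generated
by the root lattice `A₅` and its glue vector of order three. -/
theorem basisA53_generates (y : Fin 6 → ℤ) :
    (∃ c : Fin 5 → ℤ, y = c ᵥ* basisA53) ↔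
      (∑ i, y i = 0 ∧ ∀ i j, (3 : ℤ) ∣ y i - y j) := by
  constructor
  · rintro ⟨c, rfl⟩
    refine ⟨?_, ?_⟩
    · simp [Matrix.vecMul, dotProduct, basisA53, Fin.sum_univ_succ]
      ring
    · intro i j
      fin_cases i <;> fin_cases j <;>
        simp [Matrix.vecMul, dotProduct, basisA53, Fin.sum_univ_succ] <;> omega
  · rintro ⟨hs, hd⟩
    obtain ⟨a, ha⟩ := hd 1 0
    obtain ⟨b, hb⟩ := hd 2 0
    obtain ⟨d, hd3⟩ := hd 3 0
    obtain ⟨e, he⟩ := hd 4 0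
    refine ⟨![y 0, a, a + b, a + b + d, a + b + d + e + y 0], ?_⟩
    simp [Fin.sum_univ_succ] at hs
    funext i
    fin_cases i <;>
      simp [Matrix.vecMul, dotProduct, basisA53, Fin.sum_univ_succ] <;> grind

/-- The third perfect form `φ₂⁵` in five variables of Korkine and Zolotareff: the form of
Coxeter's lattice `A₅³`, scaled to arithmetic minimum `1`. -/
noncomputable def formPhi25 : Matrix (Fin 5) (Fin 5) ℝ :=
  (1 / 12 : ℝ) • (basisA53 * basisA53ᵀ).map (Int.cast : ℤ → ℝ)

/-- The form `E₆*`, the form of the dual of the root lattice `E₆`, scaled to arithmetic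
minimum `1`. -/
noncomputable def formE6Star : Matrix (Fin 6) (Fin 6) ℝ :=
  (3 / 4 : ℝ) • (CartanMatrix.E₆.map (Int.cast : ℤ → ℝ))⁻¹

/-! Write n = m+1. Everything is computed in frame coordinates x_i = v_i - v_n and t = Σ x_i + 2
v_n, which identify ℤⁿ with the integral vectors (x, t) of even coordinate sum, that is, with the
root lattice D_n. Put p = Σ x_i², s = Σ x_i, and let K be the largest even number at most m. Then g
= (t² + p)/2 is a copy of D_n with minimum 1, and 2K·TF_n = (K-1)t² + (K+2)p - s²
(`quadValue_formTF`). Equivalently TF_n = g + (2p - t² - s²)/(2K), which has the shape of Voronoi's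
passage from a perfect form to its neighbour. The direction 2p - t² - s² does not depend on K; it is
proportional to the condition that (1,…,1,-(n-3)) lie on the ellipsoid through 0 and the basis
vectors.

The minimum of TF_n comes from an integer inequality in K, s, t, p (`two_mul_le_and_eq_cases`).
Equality leaves the roots of D_n with 3t² + s² = 4, which up to sign are the nonzero vectors of the
dual of R_n, and a few vectors with all x_i in {0,-1} and extremal sum, which depend on the parity
of m and account for the two counts.

The pairing with TF_n - g is nonnegative on the domain of g and nonpositive on that of TF_n, and
vanishes on a generator exactly when its vector is minimal for both forms. As the common minimal
vectors already span a hyperplane, each form has a domain of full dimension, hence is perfect, and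
the domains meet in the common wall (`isCommonWall_of_common_minimalVectors`).

For TW(n) itself, the nonzero vectors w of the dual are indexed by m points and the unordered pairs
of m points. On ww^T the defect f[x] - Σ x_i f_ii equals a² - a with a = w·x. Suitable lattice
points x give a in {-1,2} for one generator and a in {0,1} for all others, so half their defects
form a dual family: the generators are independent and the cone is simplicial. Since R_n is its own
(0,1)-bidual (`forall_dualGenerator_dotProduct_iff`), positivity of the coordinates is the Delaunay
condition. -/

/-! ### Quadratic forms, Voronoi images and the space of symmetric matrices. -/

section General

variable {n : ℕ}

theorem toReal_neg (v : Fin n → ℤ) : toReal (-v) = -toReal v := by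
  ext i; simp [toReal]

theorem toReal_eq_zero {v : Fin n → ℤ} : toReal v = 0 ↔ v = 0 := by
  simp [toReal, funext_iff]

theorem quadValue_neg (f : Matrix (Fin n) (Fin n) ℝ) (x : Fin n → ℝ) :
    quadValue f (-x) = quadValue f x := by
  simp [quadValue, Matrix.mulVec_neg]

theorem quadValue_eq_sum (f : Matrix (Fin n) (Fin n) ℝ) (x : Fin n → ℝ) :
    quadValue f x = ∑ i, ∑ j, f i j * (x i * x j) := by
  simp only [quadValue, dotProduct, Matrix.mulVec, Finset.mul_sum]
  exact Finset.sum_congr rfl fun i _ => Finset.sum_congr rfl fun j _ => by ring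

theorem posDef_of_quadValue_pos {f : Matrix (Fin n) (Fin n) ℝ} (hs : f.IsSymm)
    (h : ∀ x : Fin n → ℝ, x ≠ 0 → 0 < quadValue f x) : f.PosDef := by
  refine Matrix.posDef_iff_dotProduct_mulVec.2 ⟨?_, fun x hx => ?_⟩
  · rw [Matrix.IsHermitian, Matrix.conjTranspose_eq_transpose_of_trivial]; exact hs
  · simpa [quadValue] using h x hx

theorem isSymm_of_posDef {f : Matrix (Fin n) (Fin n) ℝ} (hf : f.PosDef) : f.IsSymm := by
  have := hf.isHermitian
  rwa [Matrix.IsHermitian, Matrix.conjTranspose_eq_transpose_of_trivial] at this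

/-- The entrywise pairing of a matrix with a fixed matrix. -/
def entryPairing (A : Matrix (Fin n) (Fin n) ℝ) : Matrix (Fin n) (Fin n) ℝ →ₗ[ℝ] ℝ where
  toFun M := ∑ i, ∑ j, A i j * M i j
  map_add' M N := by simp [mul_add, Finset.sum_add_distrib]
  map_smul' c M := by
    simp only [Matrix.smul_apply, smul_eq_mul, RingHom.id_apply, Finset.mul_sum]
    exact Finset.sum_congr rfl fun i _ => Finset.sum_congr rfl fun j _ => by ring

theorem entryPairing_apply (A M : Matrix (Fin n) (Fin n) ℝ) :
    entryPairing A M = ∑ i, ∑ j, A i j * M i j := rfl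

theorem entryPairing_voronoiImage (A : Matrix (Fin n) (Fin n) ℝ) (v : Fin n → ℤ) :
    entryPairing A (voronoiImage v) = quadValue A (toReal v) := by
  simp [entryPairing_apply, quadValue_eq_sum, voronoiImage, Matrix.vecMulVec_apply]

theorem quadValue_sub (A B : Matrix (Fin n) (Fin n) ℝ) (x : Fin n → ℝ) :
    quadValue (A - B) x = quadValue A x - quadValue B x := by
  simp [quadValue, Matrix.sub_mulVec]

theorem entryPairing_self_eq_zero {A : Matrix (Fin n) (Fin n) ℝ} (h : entryPairing A A = 0) :
    A = 0 := by
  rw [entryPairing_apply] at h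
  have h1 := (Finset.sum_eq_zero_iff_of_nonneg
    fun i _ => Finset.sum_nonneg fun j _ => mul_self_nonneg (A i j)).1 h
  ext i j
  have := (Finset.sum_eq_zero_iff_of_nonneg fun j _ => mul_self_nonneg (A i j)).1
    (h1 i (Finset.mem_univ _)) j (Finset.mem_univ _)
  simpa using this

/-- The space of symmetric matrices. -/
def symmetricMatrices (n : ℕ) : Submodule ℝ (Matrix (Fin n) (Fin n) ℝ) where
  carrier := {M | M.IsSymm}
  add_mem' h₁ h₂ := h₁.add h₂
  zero_mem' := Matrix.isSymm_zero
  smul_mem' c _ h := h.smul c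

theorem mem_symmetricMatrices {M : Matrix (Fin n) (Fin n) ℝ} :
    M ∈ symmetricMatrices n ↔ M.IsSymm := Iff.rfl

/-- Symmetric matrices are functions on unordered pairs of indices. -/
def symmetricMatricesEquiv (n : ℕ) : symmetricMatrices n ≃ₗ[ℝ] (Sym2 (Fin n) → ℝ) where
  toFun M := Sym2.lift ⟨fun i j => M.1 i j, fun i j => (M.2.apply i j).symm⟩
  invFun c := ⟨Matrix.of fun i j => c s(i, j), by
    rw [mem_symmetricMatrices]
    ext i j
    simp [Sym2.eq_swap]⟩
  left_inv M := by ext i j; simp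
  right_inv c := by ext z; induction z with | _ i j => simp
  map_add' M N := by ext z; induction z with | _ i j => simp
  map_smul' c M := by ext z; induction z with | _ i j => simp

theorem finrank_symmetricMatrices (n : ℕ) :
    Module.finrank ℝ (symmetricMatrices n) = n * (n + 1) / 2 := by
  rw [(symmetricMatricesEquiv n).finrank_eq, Module.finrank_fintype_fun_eq_card, Sym2.card,
    Fintype.card_fin, Nat.choose_two_right, Nat.add_sub_cancel, mul_comm]

theorem voronoiImage_isSymm (v : Fin n → ℤ) : (voronoiImage v).IsSymm := by
  ext i j; simp [voronoiImage, Matrix.vecMulVec_apply, mul_comm]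

theorem voronoiImage_neg (v : Fin n → ℤ) : voronoiImage (-v) = voronoiImage v := by
  simp [voronoiImage, toReal_neg]

theorem voronoiImage_zero : voronoiImage (0 : Fin n → ℤ) = 0 := by
  ext i j; simp [voronoiImage, toReal, Matrix.vecMulVec_apply]

theorem span_coe_voronoiCone (V : Set (Fin n → ℤ)) :
    Submodule.span ℝ (voronoiCone V : Set (Matrix (Fin n) (Fin n) ℝ)) =
      Submodule.span ℝ (voronoiImage '' V) := by
  apply le_antisymm
  · exact Submodule.span_le.2 (PointedCone.hull_le_span _ _)
  · exact Submodule.span_mono PointedCone.subset_hull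

theorem coneDim_voronoiCone (V : Set (Fin n → ℤ)) :
    coneDim (voronoiCone V) = Module.finrank ℝ (Submodule.span ℝ (voronoiImage '' V)) := by
  rw [coneDim, span_coe_voronoiCone]

theorem span_voronoiImage_le (V : Set (Fin n → ℤ)) :
    Submodule.span ℝ (voronoiImage '' V) ≤ symmetricMatrices n := by
  rw [Submodule.span_le]
  rintro _ ⟨v, -, rfl⟩
  exact voronoiImage_isSymm v

/-- The Voronoi image forgets signs and kills 0, so generating sets need to agree only up to these.
This is what reconciles the dual of R_n, which contains 0 and one vector of each pair ±v, with sets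
of minimal vectors. -/
theorem voronoiCone_le {V V' : Set (Fin n → ℤ)} (h : ∀ v ∈ V, v = 0 ∨ v ∈ V' ∨ -v ∈ V') :
    voronoiCone V ≤ voronoiCone V' := by
  refine Submodule.span_le.2 ?_
  rintro _ ⟨v, hv, rfl⟩
  rcases h v hv with rfl | h | h
  · rw [voronoiImage_zero]; exact Submodule.zero_mem _
  · exact PointedCone.subset_hull ⟨v, h, rfl⟩
  · exact PointedCone.subset_hull ⟨-v, h, voronoiImage_neg v⟩

end General

/-! ### Faces and relative interiors of finitely or infinitely generated cones. -/

section Faces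

variable {E : Type*} [AddCommGroup E] [Module ℝ E]

/-- A hyperplane section of a subspace is determined by its dimension. -/
theorem inf_ker_eq_of_finrank [FiniteDimensional ℝ E] {U S : Submodule ℝ E} {φ : E →ₗ[ℝ] ℝ}
    (hUS : U ≤ S) (hd : Module.finrank ℝ U + 1 = Module.finrank ℝ S) (hU : ∀ u ∈ U, φ u = 0)
    (hS : ∃ s ∈ S, φ s ≠ 0) : U = S ⊓ LinearMap.ker φ := by
  have hle : U ≤ S ⊓ LinearMap.ker φ := le_inf hUS fun u hu => hU u hu
  refine Submodule.eq_of_le_of_finrank_le hle ?_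
  have hlt : S ⊓ LinearMap.ker φ < S := by
    refine lt_of_le_of_ne inf_le_left fun h => ?_
    obtain ⟨s, hs, hne⟩ := hS
    exact hne ((inf_eq_left.1 h) hs)
  have := Submodule.finrank_lt_finrank_of_lt hlt
  omega

/-- A subspace strictly larger than a hyperplane is everything. -/
theorem eq_of_finrank_add_one [FiniteDimensional ℝ E] {U V S : Submodule ℝ E}
    (hUV : U < V) (hVS : V ≤ S) (hd : Module.finrank ℝ U + 1 = Module.finrank ℝ S) : V = S := by
  have := Submodule.finrank_lt_finrank_of_lt hUV
  exact Submodule.eq_of_le_of_finrank_le hVS (by omega)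

/-- A sum of nonnegative terms vanishes only termwise, so a point of the cone on the supporting
hyperplane uses only generators on that hyperplane. -/
theorem hull_nonneg_and_mem_of_eq_zero {G : Set E} {φ : E →ₗ[ℝ] ℝ} (hφ : ∀ x ∈ G, 0 ≤ φ x)
    {x : E} (hx : x ∈ PointedCone.hull ℝ G) :
    0 ≤ φ x ∧ (φ x = 0 → x ∈ PointedCone.hull ℝ (G ∩ {y | φ y = 0})) := by
  induction hx using Submodule.span_induction with
  | mem x h => exact ⟨hφ x h, fun h0 => PointedCone.subset_hull ⟨h, h0⟩⟩
  | zero => simp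
  | add x y _ _ hx hy =>
    rw [map_add]
    refine ⟨add_nonneg hx.1 hy.1, fun h0 => ?_⟩
    have h1 := hx.1
    have h2 := hy.1
    exact Submodule.add_mem _ (hx.2 (by linarith)) (hy.2 (by linarith))
  | smul a x _ hx =>
    have ha : φ (a • x) = (a : ℝ) * φ x := by
      rw [show a • x = (a : ℝ) • x from rfl, map_smul, smul_eq_mul]
    rw [ha]
    refine ⟨mul_nonneg a.2 hx.1, fun h0 => ?_⟩
    rcases mul_eq_zero.1 h0 with h | h
    · rw [show a • x = (a : ℝ) • x from rfl, h, zero_smul]; exact Submodule.zero_mem _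
    · exact Submodule.smul_mem _ _ (hx.2 h)

theorem isFaceOf_hull_inter {G : Set E} {φ : E →ₗ[ℝ] ℝ} (hφ : ∀ x ∈ G, 0 ≤ φ x) :
    (PointedCone.hull ℝ (G ∩ {y | φ y = 0})).IsFaceOf (PointedCone.hull ℝ G) where
  le := Submodule.span_mono Set.inter_subset_left
  mem_of_smul_add_mem {x y a} hx hy ha h := by
    have h0 : φ (a • x + y) = 0 := by
      refine le_antisymm ?_ ?_
      · have := (hull_nonneg_and_mem_of_eq_zero (φ := -φ)
          (fun z (hz : z ∈ G ∩ {y | φ y = 0}) => by simp [show φ z = 0 from hz.2]) h).1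
        rw [LinearMap.neg_apply] at this
        linarith
      · exact (hull_nonneg_and_mem_of_eq_zero (fun z hz => hφ z hz.1) h).1
    have h1 := (hull_nonneg_and_mem_of_eq_zero hφ hx).1
    have h2 := (hull_nonneg_and_mem_of_eq_zero hφ hy).1
    rw [map_add, map_smul, smul_eq_mul] at h0
    refine (hull_nonneg_and_mem_of_eq_zero hφ hx).2 ?_
    have h3 := mul_nonneg ha.le h1
    exact (mul_eq_zero.1 (show a * φ x = 0 by linarith)).resolve_left ha.ne'

/-- Two cones separated by a hyperplane meet in the common part of their generators, when both
have the same generators on the hyperplane. -/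
theorem hull_inf_hull {G H W : Set E} {φ : E →ₗ[ℝ] ℝ} (hG : ∀ x ∈ G, 0 ≤ φ x)
    (hH : ∀ x ∈ H, φ x ≤ 0) (hW : W = G ∩ {y | φ y = 0}) (hWH : W ⊆ H) :
    PointedCone.hull ℝ G ⊓ PointedCone.hull ℝ H = PointedCone.hull ℝ W := by
  apply le_antisymm
  · rintro x ⟨hxG, hxH⟩
    have h1 := hull_nonneg_and_mem_of_eq_zero hG hxG
    have h2 := (hull_nonneg_and_mem_of_eq_zero (φ := -φ) (fun z hz => by simpa using hH z hz)
      hxH).1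
    rw [LinearMap.neg_apply] at h2
    rw [hW]
    exact h1.2 (by linarith [h1.1])
  · exact le_inf (Submodule.span_mono (hW ▸ Set.inter_subset_left)) (Submodule.span_mono hWH)

/-- The relative interior of a simplicial cone, in terms of a dual family of functionals. -/
theorem intrinsicInterior_hull_range [TopologicalSpace E] [IsTopologicalAddGroup E]
    [ContinuousSMul ℝ E] {ι : Type*} [Fintype ι] [DecidableEq ι] (M : ι → E) (φ : ι → E →ₗ[ℝ] ℝ)
    (hφ : ∀ i, Continuous (φ i)) (hd : ∀ i j, φ i (M j) = if i = j then 1 else 0) :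
    intrinsicInterior ℝ (PointedCone.hull ℝ (Set.range M) : Set E) =
      {x | x ∈ Submodule.span ℝ (Set.range M) ∧ ∀ i, 0 < φ i x} := by
  have hrep : ∀ x ∈ Submodule.span ℝ (Set.range M), x = ∑ i, φ i x • M i := by
    intro x hx
    obtain ⟨c, rfl⟩ := (Submodule.mem_span_range_iff_exists_fun ℝ).1 hx
    refine Finset.sum_congr rfl fun i _ => ?_
    simp [map_sum, hd]
  have hnonneg : ∀ x ∈ PointedCone.hull ℝ (Set.range M), ∀ i, 0 ≤ φ i x := by
    intro x hx i
    refine (hull_nonneg_and_mem_of_eq_zero (φ := φ i) ?_ hx).1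
    rintro _ ⟨j, rfl⟩
    rw [hd]; split_ifs <;> norm_num
  have hmem : ∀ x ∈ Submodule.span ℝ (Set.range M), (∀ i, 0 ≤ φ i x) →
      x ∈ PointedCone.hull ℝ (Set.range M) := by
    intro x hx h
    rw [hrep x hx]
    exact Submodule.sum_mem _ fun i _ =>
      PointedCone.smul_mem _ (h i) (PointedCone.subset_hull ⟨i, rfl⟩)
  have hspan : ∀ x, x ∈ affineSpan ℝ (PointedCone.hull ℝ (Set.range M) : Set E) ↔
      x ∈ Submodule.span ℝ (Set.range M) := by
    intro x
    have h0 : (0 : E) ∈ (PointedCone.hull ℝ (Set.range M) : Set E) := Submodule.zero_mem _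
    have h1 := affineSpan_insert_zero (k := ℝ) (PointedCone.hull ℝ (Set.range M) : Set E)
    rw [Set.insert_eq_of_mem h0] at h1
    have h2 : Submodule.span ℝ (PointedCone.hull ℝ (Set.range M) : Set E) =
        Submodule.span ℝ (Set.range M) :=
      le_antisymm (Submodule.span_le.2 (PointedCone.hull_le_span _ _))
        (Submodule.span_mono PointedCone.subset_hull)
    rw [h2] at h1
    exact Set.ext_iff.1 h1 x
  ext x
  rw [mem_intrinsicInterior]
  constructor
  · rintro ⟨y, hy, rfl⟩
    refine ⟨(hspan y).1 y.2, fun i => ?_⟩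
    -- Moving from y by -t M i stays in the affine span and lowers φ i by exactly t. As y is
    -- interior, some t = ε/2 > 0 keeps the point in the cone, whence φ i y ≥ ε/2.
    have hmemM : ∀ t : ℝ, (y : E) - t • M i ∈
        affineSpan ℝ (PointedCone.hull ℝ (Set.range M) : Set E) := fun t =>
      (hspan _).2 (Submodule.sub_mem _ ((hspan y).1 y.2)
        (Submodule.smul_mem _ _ (Submodule.subset_span ⟨i, rfl⟩)))
    have hc : Continuous fun t : ℝ => (⟨(y : E) - t • M i, hmemM t⟩ :
        affineSpan ℝ (PointedCone.hull ℝ (Set.range M) : Set E)) := by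
      fun_prop
    have hev := hc.continuousAt.preimage_mem_nhds (x := 0)
      (t := ((↑) ⁻¹' (PointedCone.hull ℝ (Set.range M) : Set E))) (by
        have : (⟨(y : E) - (0 : ℝ) • M i, hmemM 0⟩ :
            affineSpan ℝ (PointedCone.hull ℝ (Set.range M) : Set E)) = y := by
          ext; simp
        rw [this]
        exact mem_interior_iff_mem_nhds.1 hy)
    obtain ⟨ε, hε, hball⟩ := Metric.mem_nhds_iff.1 hev
    have h1 := hball (show ε / 2 ∈ Metric.ball (0 : ℝ) ε by
      rw [Metric.mem_ball, Real.dist_eq, sub_zero, abs_of_pos (by linarith)]; linarith)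
    have h2 := hnonneg _ h1 i
    rw [map_sub, map_smul, hd, if_pos rfl, smul_eq_mul] at h2
    linarith
  · rintro ⟨hx, hpos⟩
    refine ⟨⟨x, (hspan x).2 hx⟩, ?_, rfl⟩
    rw [mem_interior]
    refine ⟨{y | ∀ i, 0 < φ i y}, ?_, ?_, hpos⟩
    · intro y hy
      exact hmem _ ((hspan y).1 y.2) fun i => (hy i).le
    · rw [Set.ofPred_forall]
      exact isOpen_iInter_of_finite fun i =>
        isOpen_lt continuous_const ((hφ i).comp continuous_subtype_val)

end Faces

/-! ### Perfection and common walls from minimal vectors. -/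

section PerfectForms

variable {n : ℕ}

theorem quadValue_of_mem_minimalVectors {f : Matrix (Fin n) (Fin n) ℝ} {m : ℝ}
    (hm : IsArithmeticMinimum f m) {v : Fin n → ℤ} :
    v ∈ minimalVectors f ↔ v ≠ 0 ∧ quadValue f (toReal v) = m := by
  obtain ⟨⟨u, hu, hum⟩, hlow⟩ := hm
  constructor
  · rintro ⟨hv, h⟩
    exact ⟨hv, le_antisymm (hum ▸ h u hu) (hlow ⟨v, hv, rfl⟩)⟩
  · rintro ⟨hv, h⟩
    exact ⟨hv, fun w hw => h ▸ hlow ⟨w, hw, rfl⟩⟩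

/-- A positive definite form whose domain spans the space of symmetric matrices is perfect. -/
theorem isPerfectForm_of_span {f : Matrix (Fin n) (Fin n) ℝ} (hf : f.PosDef)
    (h : Submodule.span ℝ (voronoiImage '' minimalVectors f) = symmetricMatrices n) :
    IsPerfectForm f := by
  refine ⟨hf, fun m hm A hA hv => ?_⟩
  -- A - f is itself symmetric, so once it pairs to zero with all symmetric matrices it pairs to
  -- zero with itself.
  have hle : symmetricMatrices n ≤ LinearMap.ker (entryPairing (A - f)) := by
    rw [← h, Submodule.span_le]
    rintro _ ⟨v, hvm, rfl⟩
    change entryPairing _ _ = 0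
    rw [entryPairing_voronoiImage, quadValue_sub, hv v hvm,
      ((quadValue_of_mem_minimalVectors hm).1 hvm).2, sub_self]
  exact sub_eq_zero.1 (entryPairing_self_eq_zero (hle (hA.sub (isSymm_of_posDef hf))))

/-- If the Voronoi images of the common minimal vectors of two forms with the same arithmetic
minimum span a hyperplane, then both forms are perfect and their domains have the cone of the
common minimal vectors as a common wall. -/
theorem isCommonWall_of_common_minimalVectors {f g : Matrix (Fin n) (Fin n) ℝ} {m : ℝ}
    (hf : f.PosDef) (hg : g.PosDef) (hfm : IsArithmeticMinimum f m)
    (hgm : IsArithmeticMinimum g m)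
    (hd : coneDim (voronoiCone (minimalVectors g ∩ minimalVectors f)) + 1 = n * (n + 1) / 2)
    (hfg : ∃ v ∈ minimalVectors f, v ∉ minimalVectors g)
    (hgf : ∃ v ∈ minimalVectors g, v ∉ minimalVectors f) :
    IsPerfectForm f ∧ IsPerfectForm g ∧
      IsCommonWall (voronoiCone (minimalVectors g ∩ minimalVectors f)) (perfectDomain g)
        (perfectDomain f) := by
  have hmf := fun v => quadValue_of_mem_minimalVectors hfm (v := v)
  have hmg := fun v => quadValue_of_mem_minimalVectors hgm (v := v)
  -- On vv^T this is f[v] - g[v]: at least m - m for v minimal for g, at most m - m for v minimal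
  -- for f, and zero in either case exactly when v is minimal for both.
  set φ := entryPairing (f - g) with hφ
  have hφv : ∀ v, φ (voronoiImage v) = quadValue f (toReal v) - quadValue g (toReal v) := by
    intro v; rw [hφ, entryPairing_voronoiImage, quadValue_sub]
  have hG : ∀ x ∈ voronoiImage '' minimalVectors g, 0 ≤ φ x := by
    rintro _ ⟨v, hv, rfl⟩
    rw [hφv, ((hmg v).1 hv).2, sub_nonneg]
    exact hfm.2 ⟨v, hv.1, rfl⟩
  have hF : ∀ x ∈ voronoiImage '' minimalVectors f, φ x ≤ 0 := by
    rintro _ ⟨v, hv, rfl⟩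
    rw [hφv, ((hmf v).1 hv).2, sub_nonpos]
    exact hgm.2 ⟨v, hv.1, rfl⟩
  have hW1 : voronoiImage '' (minimalVectors g ∩ minimalVectors f) =
      voronoiImage '' minimalVectors g ∩ {y | φ y = 0} := by
    ext x; constructor
    · rintro ⟨v, ⟨h1, h2⟩, rfl⟩
      refine ⟨⟨v, h1, rfl⟩, ?_⟩
      rw [Set.mem_ofPred_eq, hφv, ((hmg v).1 h1).2, ((hmf v).1 h2).2, sub_self]
    · rintro ⟨⟨v, h1, rfl⟩, h2⟩
      refine ⟨v, ⟨h1, (hmf v).2 ⟨h1.1, ?_⟩⟩, rfl⟩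
      rw [Set.mem_ofPred_eq, hφv, ((hmg v).1 h1).2] at h2
      linarith
  have hW2 : voronoiImage '' (minimalVectors g ∩ minimalVectors f) =
      voronoiImage '' minimalVectors f ∩ {y | (-φ) y = 0} := by
    ext x; constructor
    · rintro ⟨v, ⟨h1, h2⟩, rfl⟩
      refine ⟨⟨v, h2, rfl⟩, ?_⟩
      rw [Set.mem_ofPred_eq, LinearMap.neg_apply, hφv, ((hmg v).1 h1).2, ((hmf v).1 h2).2,
        sub_self, neg_zero]
    · rintro ⟨⟨v, h1, rfl⟩, h2⟩
      refine ⟨v, ⟨(hmg v).2 ⟨h1.1, ?_⟩, h1⟩, rfl⟩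
      rw [Set.mem_ofPred_eq, LinearMap.neg_apply, hφv, ((hmf v).1 h1).2] at h2
      linarith
  have hker : ∀ x ∈ Submodule.span ℝ (voronoiImage '' (minimalVectors g ∩ minimalVectors f)),
      φ x = 0 := by
    intro x hx
    refine (Submodule.span_le (p := LinearMap.ker φ)).2 ?_ hx
    intro y hy
    rw [hW1] at hy
    exact hy.2
  rw [coneDim_voronoiCone] at hd
  -- A minimal vector of g that is not minimal for f lies off the hyperplane φ = 0, which contains
  -- the span of the common ones; so the span of the domain exceeds a hyperplane.
  have hspang : Submodule.span ℝ (voronoiImage '' minimalVectors g) = symmetricMatrices n := by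
    refine eq_of_finrank_add_one (lt_of_le_of_ne (Submodule.span_mono
      (Set.image_mono Set.inter_subset_left)) fun h => ?_) (span_voronoiImage_le _)
      (by rw [finrank_symmetricMatrices]; exact hd)
    obtain ⟨v, hv, hv'⟩ := hgf
    have h0 := hker (voronoiImage v) (h ▸ Submodule.subset_span ⟨v, hv, rfl⟩)
    rw [hφv, ((hmg v).1 hv).2] at h0
    exact hv' ((hmf v).2 ⟨hv.1, by linarith⟩)
  have hspanf : Submodule.span ℝ (voronoiImage '' minimalVectors f) = symmetricMatrices n := by
    refine eq_of_finrank_add_one (lt_of_le_of_ne (Submodule.span_mono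
      (Set.image_mono Set.inter_subset_right)) fun h => ?_) (span_voronoiImage_le _)
      (by rw [finrank_symmetricMatrices]; exact hd)
    obtain ⟨v, hv, hv'⟩ := hfg
    have h0 := hker (voronoiImage v) (h ▸ Submodule.subset_span ⟨v, hv, rfl⟩)
    rw [hφv, ((hmf v).1 hv).2] at h0
    exact hv' ((hmg v).2 ⟨hv.1, by linarith⟩)
  refine ⟨isPerfectForm_of_span hf hspanf, isPerfectForm_of_span hg hspang, ⟨?_, ?_⟩, ⟨?_, ?_⟩, ?_⟩
  · rw [voronoiCone, hW1]
    exact isFaceOf_hull_inter hG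
  · rw [perfectDomain, coneDim_voronoiCone, coneDim_voronoiCone, hspang,
      finrank_symmetricMatrices, hd]
  · rw [voronoiCone, hW2]
    refine isFaceOf_hull_inter fun x hx => ?_
    rw [LinearMap.neg_apply, neg_nonneg]
    exact hF x hx
  · rw [perfectDomain, coneDim_voronoiCone, coneDim_voronoiCone, hspanf,
      finrank_symmetricMatrices, hd]
  · exact hull_inf_hull hG hF hW1 (Set.image_mono Set.inter_subset_right)

end PerfectForms

/-! ### The (0,1)-dual of the repartitioning complex and its bidual. -/

section Dual

variable {m : ℕ}

theorem dotProduct_eq_castSucc_add_last {R : Type*} [CommRing R] (w x : Fin (m + 1) → R) :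
    w ⬝ᵥ x = ∑ i : Fin m, w i.castSucc * x i.castSucc + w (Fin.last m) * x (Fin.last m) := by
  rw [dotProduct, Fin.sum_univ_castSucc]

theorem mem_repartitioningComplex {x : Fin (m + 1) → ℤ} :
    x ∈ repartitioningComplex (m + 1) ↔ x = 0 ∨ (∃ i : Fin m, x = Pi.single i.castSucc 1) ∨
      x = Pi.single (Fin.last m) 1 ∨ x = Fin.snoc (α := fun _ => ℤ) (fun _ => 1) (2 - (m : ℤ)) := by
  have h1 : (fun i : Fin (m + 1) => if (i : ℕ) + 1 < m + 1 then (1 : ℤ)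
      else -(((m + 1 : ℕ) : ℤ) - 3)) = Fin.snoc (α := fun _ => ℤ) (fun _ => 1) (2 - (m : ℤ)) := by
    ext i
    refine Fin.lastCases ?_ (fun i => ?_) i
    · simp; ring
    · simp
  have h2 : (fun i : Fin (m + 1) => if (i : ℕ) + 1 < m + 1 then (0 : ℤ) else 1) =
      Pi.single (Fin.last m) 1 := by
    ext i
    refine Fin.lastCases ?_ (fun i => ?_) i
    · simp
    · simp [(Fin.castSucc_lt_last i).ne]
  have h3 : (∃ i : Fin (m + 1), (i : ℕ) + 1 < m + 1 ∧ x = Pi.single i 1) ↔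
      ∃ i : Fin m, x = Pi.single i.castSucc 1 := by
    constructor
    · rintro ⟨i, hi, rfl⟩
      exact ⟨⟨i, by omega⟩, rfl⟩
    · rintro ⟨i, rfl⟩
      exact ⟨i.castSucc, by simp, rfl⟩
  simp only [repartitioningComplex, bigSimplex, Set.mem_union, Set.mem_ofPred_eq, h1, h2, h3]
  tauto

theorem mem_zeroOneDual {w : Fin (m + 1) → ℤ} :
    w ∈ zeroOneDual (repartitioningComplex (m + 1)) ↔
      (∀ i : Fin m, w i.castSucc = 0 ∨ w i.castSucc = 1) ∧
      (w (Fin.last m) = 0 ∨ w (Fin.last m) = 1) ∧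
      (∑ i : Fin m, w i.castSucc + w (Fin.last m) * (2 - (m : ℤ)) = 0 ∨
        ∑ i : Fin m, w i.castSucc + w (Fin.last m) * (2 - (m : ℤ)) = 1) := by
  have hsn : w ⬝ᵥ (Fin.snoc (α := fun _ => ℤ) (fun _ => 1) (2 - (m : ℤ))) =
      ∑ i : Fin m, w i.castSucc + w (Fin.last m) * (2 - (m : ℤ)) := by
    simp [dotProduct_eq_castSucc_add_last]
  constructor
  · intro h
    refine ⟨fun i => ?_, ?_, ?_⟩
    · simpa using h _ (mem_repartitioningComplex.2 (Or.inr (Or.inl ⟨i, rfl⟩)))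
    · simpa using h _ (mem_repartitioningComplex.2 (Or.inr (Or.inr (Or.inl rfl))))
    · rw [← hsn]
      exact h _ (mem_repartitioningComplex.2 (Or.inr (Or.inr (Or.inr rfl))))
  · rintro ⟨h1, h2, h3⟩ v hv
    rcases mem_repartitioningComplex.1 hv with rfl | ⟨i, rfl⟩ | rfl | rfl
    · simp
    · simpa using h1 i
    · simpa using h2
    · rwa [hsn]

/-- The nonzero vectors of the `(0,1)`-dual of the repartitioning complex. -/
def dualGenerator : Fin m ⊕ Sym2 (Fin m) → Fin (m + 1) → ℤ
  | .inl i => Fin.snoc (α := fun _ => ℤ) (Pi.single i 1) 0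
  | .inr z => Fin.snoc (α := fun _ => ℤ) (fun k => if k ∈ z then 0 else 1) 1

/-- A lattice point whose product with a given dual generator is neither `0` nor `1`, while its
products with all others are. -/
def dualTest : Fin m ⊕ Sym2 (Fin m) → Fin (m + 1) → ℤ
  | .inl i => Fin.snoc (α := fun _ => ℤ) (-Pi.single i 1) 1
  | .inr z => if z.IsDiag then
      Fin.snoc (α := fun _ => ℤ) (fun k => if k ∈ z then 0 else 1) (3 - (m : ℤ))
    else Fin.snoc (α := fun _ => ℤ) (fun k => if k ∈ z then 1 else 0) (-1)

/-- Diagonal pairs are admitted throughout, so that one index type covers complements of one point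
and of two points; the conditional avoids subtracting the same point twice. -/
theorem sum_ite_mem_sym2_mul {R : Type*} [CommRing R] (i j : Fin m) (a : Fin m → R) :
    ∑ k, (if k ∈ s(i, j) then 0 else 1) * a k = ∑ k, a k - a i - if i = j then 0 else a j := by
  have h : ∀ k, (if k ∈ s(i, j) then (0 : R) else 1) * a k =
      a k - (if k = i then a k else 0) - (if k = j then (if i = j then 0 else a k) else 0) := by
    intro k
    simp only [Sym2.mem_iff]
    split_ifs <;> simp_all
  simp only [h, Finset.sum_sub_distrib, Finset.sum_ite_eq', Finset.mem_univ, if_true]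

theorem toReal_dualGenerator_dotProduct_inl (i : Fin m) (x : Fin (m + 1) → ℝ) :
    toReal (dualGenerator (.inl i)) ⬝ᵥ x = x i.castSucc := by
  simp [dotProduct_eq_castSucc_add_last, dualGenerator, toReal, Pi.single_apply]

theorem toReal_dualGenerator_dotProduct_inr (i j : Fin m) (x : Fin (m + 1) → ℝ) :
    toReal (dualGenerator (.inr s(i, j))) ⬝ᵥ x =
      ∑ k, x k - x i.castSucc - if i = j then 0 else x j.castSucc := by
  have := sum_ite_mem_sym2_mul i j fun k => x k.castSucc
  rw [Fin.sum_univ_castSucc, dotProduct_eq_castSucc_add_last]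
  simp only [toReal, dualGenerator, Fin.snoc_castSucc, Fin.snoc_last]
  push_cast
  rw [this]
  ring

theorem dualGenerator_dotProduct_inl (i : Fin m) (x : Fin (m + 1) → ℤ) :
    dualGenerator (.inl i) ⬝ᵥ x = x i.castSucc := by
  simp [dotProduct_eq_castSucc_add_last, dualGenerator, Pi.single_apply]

theorem dualGenerator_dotProduct_inr (i j : Fin m) (x : Fin (m + 1) → ℤ) :
    dualGenerator (.inr s(i, j)) ⬝ᵥ x =
      ∑ k, x k - x i.castSucc - if i = j then 0 else x j.castSucc := by
  have := sum_ite_mem_sym2_mul i j fun k => x k.castSucc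
  rw [Fin.sum_univ_castSucc, dotProduct_eq_castSucc_add_last]
  simp only [dualGenerator, Fin.snoc_castSucc, Fin.snoc_last]
  rw [this]
  ring

/-- An integral `(0,1)`-vector with coordinate sum one is a unit vector. -/
theorem exists_eq_single_of_sum_eq_one {a : Fin m → ℤ} (h : ∀ i, a i = 0 ∨ a i = 1)
    (hs : ∑ i, a i = 1) : ∃ i, a = Pi.single i 1 := by
  have hcard : (Finset.univ.filter fun i => a i = 1).card = 1 := by
    have : ∑ i, a i = ∑ i, if a i = 1 then 1 else 0 :=
      Finset.sum_congr rfl fun i _ => by rcases h i with h | h <;> simp [h]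
    rw [this, Finset.sum_boole] at hs
    exact_mod_cast hs
  obtain ⟨i, hi⟩ := Finset.card_eq_one.1 hcard
  refine ⟨i, funext fun k => ?_⟩
  have hk : a k = 1 ↔ k = i := by simpa using Finset.ext_iff.1 hi k
  by_cases hki : k = i
  · rw [hk.2 hki, hki, Pi.single_eq_same]
  · rw [Pi.single_eq_of_ne hki]
    exact (h k).resolve_right fun h => hki (hk.1 h)

/-- An integral `(0,1)`-vector with coordinate sum one or two is the indicator function of an
unordered pair. -/
theorem exists_eq_ite_mem_sym2 {a : Fin m → ℤ} (h : ∀ i, a i = 0 ∨ a i = 1)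
    (hs : ∑ i, a i = 1 ∨ ∑ i, a i = 2) :
    ∃ z : Sym2 (Fin m), ∀ k, a k = if k ∈ z then 1 else 0 := by
  rcases hs with hs | hs
  · obtain ⟨i, rfl⟩ := exists_eq_single_of_sum_eq_one h hs
    exact ⟨s(i, i), fun k => by simp [Pi.single_apply]⟩
  · have hcard : (Finset.univ.filter fun i => a i = 1).card = 2 := by
      have : ∑ i, a i = ∑ i, if a i = 1 then 1 else 0 :=
        Finset.sum_congr rfl fun i _ => by rcases h i with h | h <;> simp [h]
      rw [this, Finset.sum_boole] at hs
      exact_mod_cast hs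
    obtain ⟨i, j, -, hij⟩ := Finset.card_eq_two.1 hcard
    refine ⟨s(i, j), fun k => ?_⟩
    have hk : a k = 1 ↔ k = i ∨ k = j := by simpa using Finset.ext_iff.1 hij k
    simp only [Sym2.mem_iff]
    split_ifs with hc
    · exact hk.2 hc
    · exact (h k).resolve_right fun h => hc (hk.1 h)

theorem sum_ite_mem_sym2 {R : Type*} [CommRing R] (i j : Fin m) :
    ∑ k, (if k ∈ s(i, j) then (0 : R) else 1) = m - 1 - if i = j then 0 else 1 := by
  simpa using sum_ite_mem_sym2_mul (R := R) i j fun _ => 1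

/-- If the last coordinate is 0, the other 0-1 coordinates sum to 0 or 1. If it is 1, they sum to
m-2 or m-1, so one or two of them vanish, which is an unordered pair, possibly diagonal. -/
theorem mem_zeroOneDual_iff {w : Fin (m + 1) → ℤ} :
    w ∈ zeroOneDual (repartitioningComplex (m + 1)) ↔ w = 0 ∨ ∃ k, w = dualGenerator k := by
  rw [mem_zeroOneDual]
  constructor
  · rintro ⟨h1, h2 | h2, h3⟩
    · rw [h2, zero_mul, add_zero] at h3
      rcases h3 with h3 | h3
      · left
        have hz := (Finset.sum_eq_zero_iff_of_nonneg fun i _ => by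
          rcases h1 i with h | h <;> simp [h]).1 h3
        ext i
        refine Fin.lastCases h2 (fun i => hz i (Finset.mem_univ i)) i
      · right
        obtain ⟨i, hi⟩ := exists_eq_single_of_sum_eq_one h1 h3
        refine ⟨.inl i, ?_⟩
        rw [dualGenerator, ← hi, ← h2]
        exact (Fin.snoc_init_self w).symm
    · right
      have hs : ∑ i : Fin m, (1 - w i.castSucc) = m - ∑ i : Fin m, w i.castSucc := by
        simp
      obtain ⟨z, hz⟩ := exists_eq_ite_mem_sym2 (a := fun i : Fin m => 1 - w i.castSucc)
        (fun i => by rcases h1 i with h | h <;> simp [h])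
        (by rw [hs]; rw [h2] at h3; omega)
      refine ⟨.inr z, ?_⟩
      ext i
      refine Fin.lastCases (by simpa [dualGenerator] using h2) (fun i => ?_) i
      have := hz i
      simp only [dualGenerator, Fin.snoc_castSucc]
      split_ifs at this ⊢ <;> omega
  · rintro (rfl | ⟨k, rfl⟩)
    · simp
    rcases k with i | z
    · simp [dualGenerator, Pi.single_apply]
      intro k; tauto
    · induction z with | _ i j =>
      refine ⟨fun k => ?_, ?_, ?_⟩
      · simp only [dualGenerator, Fin.snoc_castSucc]; split_ifs <;> simp
      · simp [dualGenerator]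
      · simp only [dualGenerator, Fin.snoc_castSucc, Fin.snoc_last, sum_ite_mem_sym2]
        split_ifs <;> omega

/-- The `(0,1)`-dual of the `(0,1)`-dual of the repartitioning complex is the complex itself. -/
theorem forall_dualGenerator_dotProduct_iff (hm : 4 ≤ m) {x : Fin (m + 1) → ℤ} :
    (∀ k, dualGenerator k ⬝ᵥ x = 0 ∨ dualGenerator k ⬝ᵥ x = 1) ↔
      x ∈ repartitioningComplex (m + 1) := by
  constructor
  swap
  · intro hx k
    exact mem_zeroOneDual_iff.2 (Or.inr ⟨k, rfl⟩) x hx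
  intro h
  have h1 : ∀ i : Fin m, x i.castSucc = 0 ∨ x i.castSucc = 1 := fun i => by
    simpa [dualGenerator_dotProduct_inl] using h (.inl i)
  have h2 : ∀ i : Fin m, ∑ k, x k - x i.castSucc = 0 ∨ ∑ k, x k - x i.castSucc = 1 := fun i => by
    simpa [dualGenerator_dotProduct_inr] using h (.inr s(i, i))
  have h3 : ∀ i j : Fin m, i ≠ j → ∑ k, x k - x i.castSucc - x j.castSucc = 0 ∨
      ∑ k, x k - x i.castSucc - x j.castSucc = 1 := fun i j hij => by
    simpa [dualGenerator_dotProduct_inr, hij] using h (.inr s(i, j))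
  rw [mem_repartitioningComplex]
  have hsum : ∑ k, x k = ∑ i : Fin m, x i.castSucc + x (Fin.last m) := Fin.sum_univ_castSucc _
  set y := ∑ k, x k with hy
  -- With y the full coordinate sum, the conditions say that x_i, y - x_i and y - x_i - x_j lie in
  -- {0,1}. All x_i = 1 forces y = 2, the vertex (1,…,1,2-m).
  by_cases hall : ∀ i : Fin m, x i.castSucc = 1
  · right; right; right
    have hs : ∑ i : Fin m, x i.castSucc = m := by simp [hall]
    have a := h2 ⟨0, by omega⟩
    have b := h3 ⟨0, by omega⟩ ⟨1, by omega⟩ (by simp)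
    rw [hall] at a b
    rw [hall] at b
    ext i
    refine Fin.lastCases ?_ (fun i => ?_) i
    · simp; omega
    · simp [hall]
  · push Not at hall
    obtain ⟨i₀, hi₀⟩ := hall
    have hi₀' := (h1 i₀).resolve_right hi₀
    by_cases hone : ∃ i : Fin m, x i.castSucc = 1
    · obtain ⟨i, hi⟩ := hone
      right; left
      -- A vanishing x_{i₀} gives y ≤ 1, while two coordinates equal to 1 would give y ≥ 2.
      have hother : ∀ j, j ≠ i → x j.castSucc = 0 := by
        intro j hj
        refine (h1 j).resolve_right fun hj1 => ?_
        have a := h3 i j hj.symm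
        have b := h2 i₀
        omega
      have hs : ∑ j : Fin m, x j.castSucc = 1 := by
        rw [Finset.sum_eq_single i (fun j _ hj => hother j hj) (by simp), hi]
      refine ⟨i, ?_⟩
      obtain ⟨j, hj1, hj2⟩ : ∃ j : Fin m, j ≠ i ∧ j ≠ i₀ := by
        have : 2 < (Finset.univ : Finset (Fin m)).card := by simp; omega
        obtain ⟨j, -, hj⟩ := Finset.exists_mem_notMem_of_card_lt_card (s := {i, i₀})
          (t := Finset.univ) (lt_of_le_of_lt Finset.card_le_two this)
        simp only [Finset.mem_insert, Finset.mem_singleton, not_or] at hj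
        exact ⟨j, hj⟩
      have a := h2 i
      have b := h2 i₀
      have c := h3 i i₀ (by rintro rfl; omega)
      ext k
      refine Fin.lastCases ?_ (fun k => ?_) k
      · rw [Pi.single_eq_of_ne (Fin.castSucc_lt_last i).ne']
        omega
      · by_cases hk : k = i
        · rw [hk, hi, Pi.single_eq_same]
        · rw [hother k hk, Pi.single_eq_of_ne (by simpa using hk)]
    · push Not at hone
      have h0 : ∀ i : Fin m, x i.castSucc = 0 := fun i => (h1 i).resolve_right (hone i)
      have hs : ∑ i : Fin m, x i.castSucc = 0 := by simp [h0]
      have a := h2 i₀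
      have hl : x (Fin.last m) = 0 ∨ x (Fin.last m) = 1 := by omega
      rcases hl with hl | hl
      · left
        ext k
        exact Fin.lastCases hl h0 k
      · right; right; left
        ext k
        refine Fin.lastCases (by simp [hl]) (fun k => ?_) k
        rw [h0, Pi.single_eq_of_ne (Fin.castSucc_lt_last k).ne]

theorem sum_dualTest_inr (i j : Fin m) :
    ∑ k, dualTest (.inr s(i, j)) k = if i = j then 2 else 1 := by
  have h := sum_ite_mem_sym2 (R := ℤ) i j
  have h1 : ∀ k, (if k ∈ s(i, j) then (1 : ℤ) else 0) =
      1 - if k ∈ s(i, j) then (0 : ℤ) else 1 := fun k => by split_ifs <;> rfl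
  rw [Fin.sum_univ_castSucc]
  by_cases hij : i = j
  · simp only [dualTest, Sym2.mk_isDiag_iff, if_pos hij, Fin.snoc_castSucc, Fin.snoc_last, h]
    ring
  · simp only [dualTest, Sym2.mk_isDiag_iff, if_neg hij, Fin.snoc_castSucc, Fin.snoc_last, h1,
      Finset.sum_sub_distrib, h]
    simp
    ring

theorem dualGenerator_dotProduct_dualTest_self (k : Fin m ⊕ Sym2 (Fin m)) :
    dualGenerator k ⬝ᵥ dualTest k = -1 ∨ dualGenerator k ⬝ᵥ dualTest k = 2 := by
  rcases k with i | z
  · simp [dualGenerator_dotProduct_inl, dualTest]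
  · induction z with | _ i j =>
    rw [dualGenerator_dotProduct_inr, sum_dualTest_inr]
    by_cases hij : i = j
    · subst hij; simp [dualTest]
    · simp [dualTest, hij]

theorem dualGenerator_dotProduct_dualTest_of_ne {k l : Fin m ⊕ Sym2 (Fin m)}
    (h : k ≠ l) : dualGenerator k ⬝ᵥ dualTest l = 0 ∨ dualGenerator k ⬝ᵥ dualTest l = 1 := by
  rcases l with i | z
  · have hs : ∑ k, dualTest (.inl i) k = 0 := by
      rw [Fin.sum_univ_castSucc]; simp [dualTest]
    rcases k with a | z
    · rw [dualGenerator_dotProduct_inl]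
      have : a ≠ i := fun h' => h (by rw [h'])
      simp [dualTest, Pi.single_eq_of_ne this]
    · induction z with | _ a b =>
      rw [dualGenerator_dotProduct_inr, hs]
      simp only [dualTest, Fin.snoc_castSucc, Pi.neg_apply, Pi.single_apply]
      split_ifs <;> simp_all
  · induction z with | _ i j =>
    by_cases hij : i = j
    · subst hij
      rcases k with a | z
      · rw [dualGenerator_dotProduct_inl]
        simp only [dualTest, Sym2.mk_isDiag_iff, if_true, Fin.snoc_castSucc]
        split_ifs <;> simp
      · induction z with | _ a b =>
        rw [dualGenerator_dotProduct_inr, sum_dualTest_inr]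
        have h' : ¬ (a = i ∧ b = i) := by rintro ⟨rfl, rfl⟩; exact h rfl
        simp only [dualTest, Sym2.mk_isDiag_iff, if_true, Fin.snoc_castSucc, Sym2.mem_iff,
          or_self]
        split_ifs <;> simp_all
    · rcases k with a | z
      · rw [dualGenerator_dotProduct_inl]
        simp only [dualTest, Sym2.mk_isDiag_iff, if_neg hij, Fin.snoc_castSucc]
        split_ifs <;> simp
      · induction z with | _ a b =>
        rw [dualGenerator_dotProduct_inr, sum_dualTest_inr]
        have h' : ¬ (a = i ∧ b = j) := by rintro ⟨rfl, rfl⟩; exact h rfl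
        have h'' : ¬ (a = j ∧ b = i) := by rintro ⟨rfl, rfl⟩; exact h (by rw [Sym2.eq_swap])
        simp only [dualTest, Sym2.mk_isDiag_iff, if_neg hij, Fin.snoc_castSucc, Sym2.mem_iff]
        split_ifs with h1 h2 h3 <;> try simp
        rcases h1 with rfl | rfl <;> rcases h3 with rfl | rfl <;> simp_all

end Dual

/-! ### Delaunay cells expressed by linear conditions on the form. -/

section Delaunay

variable {n : ℕ}

/-- The excess `f[x] - ∑ i, xᵢ fᵢᵢ` of the lattice point `x` over the ellipsoid through the origin
and the basis vectors. -/
def latticeDefect (x : Fin n → ℤ) : Matrix (Fin n) (Fin n) ℝ →ₗ[ℝ] ℝ :=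
  entryPairing (voronoiImage x - Matrix.diagonal (toReal x))

theorem latticeDefect_apply (x : Fin n → ℤ) (f : Matrix (Fin n) (Fin n) ℝ) :
    latticeDefect x f = quadValue f (toReal x) - ∑ i, toReal x i * f i i := by
  simp only [latticeDefect, entryPairing_apply, quadValue_eq_sum, Matrix.sub_apply, sub_mul,
    Finset.sum_sub_distrib, voronoiImage, Matrix.vecMulVec_apply, Matrix.diagonal_apply]
  congr 1
  · exact Finset.sum_congr rfl fun i _ => Finset.sum_congr rfl fun j _ => by ring
  · exact Finset.sum_congr rfl fun i _ => by simp

theorem continuous_latticeDefect (x : Fin n → ℤ) : Continuous (latticeDefect x) := by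
  have h : Continuous fun f : Matrix (Fin n) (Fin n) ℝ =>
      ∑ i, ∑ j, (voronoiImage x - Matrix.diagonal (toReal x)) i j * f i j := by
    fun_prop
  exact h

theorem quadValue_voronoiImage (w : Fin n → ℤ) (y : Fin n → ℝ) :
    quadValue (voronoiImage w) y = (toReal w ⬝ᵥ y) ^ 2 := by
  rw [quadValue, voronoiImage, Matrix.vecMulVec_mulVec, dotProduct_comm, sq]
  simp

theorem toReal_dotProduct (w x : Fin n → ℤ) : toReal w ⬝ᵥ toReal x = ((w ⬝ᵥ x : ℤ) : ℝ) := by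
  simp [dotProduct, toReal]

theorem toReal_single (i : Fin n) : toReal (Pi.single i 1) = Pi.single i 1 := by
  ext j; simp [toReal, Pi.single_apply]

/-- The entries of w are its products with the basis vectors, hence 0 or 1, so w_i² = w_i and the
linear part collapses to w·x. The resulting a² - a is nonnegative at integers and zero only at 0 and
1. -/
theorem latticeDefect_voronoiImage {V : Set (Fin n → ℤ)} (hV : ∀ i, Pi.single i 1 ∈ V)
    {w : Fin n → ℤ} (hw : w ∈ zeroOneDual V) (x : Fin n → ℤ) :
    latticeDefect x (voronoiImage w) = ((w ⬝ᵥ x : ℤ) : ℝ) ^ 2 - ((w ⬝ᵥ x : ℤ) : ℝ) := by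
  rw [latticeDefect_apply, quadValue_voronoiImage, toReal_dotProduct, ← toReal_dotProduct,
    dotProduct]
  congr 1
  refine Finset.sum_congr rfl fun i _ => ?_
  have : w i = 0 ∨ w i = 1 := by simpa using hw _ (hV i)
  rcases this with h | h <;> simp [voronoiImage, Matrix.vecMulVec_apply, toReal, h]

theorem quadValue_sub_vec {f : Matrix (Fin n) (Fin n) ℝ} (hf : f.IsSymm) (x c : Fin n → ℝ) :
    quadValue f (x - c) = quadValue f x - 2 * (x ⬝ᵥ (f *ᵥ c)) + quadValue f c := by
  have h : c ⬝ᵥ (f *ᵥ x) = x ⬝ᵥ (f *ᵥ c) := by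
    rw [Matrix.dotProduct_mulVec, ← Matrix.mulVec_transpose, hf.eq, dotProduct_comm]
  simp only [quadValue, Matrix.mulVec_sub, sub_dotProduct, dotProduct_sub, h]
  ring

theorem quadValue_single (f : Matrix (Fin n) (Fin n) ℝ) (i : Fin n) :
    quadValue f (Pi.single i 1) = f i i := by
  simp [quadValue]

/-- For a set containing the origin and the basis vectors, being a Delaunay cell is a condition on
the excesses of the lattice points. -/
theorem isDelaunayCell_iff {f : Matrix (Fin n) (Fin n) ℝ} (hf : f.PosDef)
    {V : Set (Fin n → ℤ)} (h0 : 0 ∈ V) (hV : ∀ i, Pi.single i 1 ∈ V) :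
    IsDelaunayCell f V ↔ ∀ x, 0 ≤ latticeDefect x f ∧ (x ∈ V ↔ latticeDefect x f = 0) := by
  have hs := isSymm_of_posDef hf
  constructor
  · rintro ⟨c, r, hr, rfl, -⟩
    have hr0 : quadValue f c = r := by
      have : quadValue f (toReal 0 - c) = r := h0
      rwa [toReal_eq_zero.2 rfl, zero_sub, quadValue_neg] at this
    -- Subtracting the equation at 0 from that at a basis vector makes the condition linear in c;
    -- thus the centre is determined by the diagonal of f.
    have hc : ∀ i, f i i = 2 * (f *ᵥ c) i := by
      intro i
      have : quadValue f (toReal (Pi.single i 1) - c) = r := hV i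
      rw [quadValue_sub_vec hs, toReal_single, quadValue_single, single_one_dotProduct] at this
      linarith
    have hx : ∀ x : Fin n → ℤ, latticeDefect x f = quadValue f (toReal x - c) - r := by
      intro x
      rw [latticeDefect_apply, quadValue_sub_vec hs, hr0]
      simp only [hc, dotProduct, Finset.mul_sum]
      have : ∑ i, toReal x i * (2 * (f *ᵥ c) i) = ∑ i, 2 * (toReal x i * (f *ᵥ c) i) :=
        Finset.sum_congr rfl fun i _ => by ring
      rw [this]
      ring
    intro x
    rw [hx, sub_nonneg, sub_eq_zero]
    exact ⟨hr x, Iff.rfl⟩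
  · intro h
    have hu : IsUnit f.det := (Matrix.isUnit_iff_isUnit_det f).1 hf.isUnit
    set c : Fin n → ℝ := f⁻¹ *ᵥ fun i => f i i / 2 with hc
    have hfc : f *ᵥ c = fun i => f i i / 2 := by
      rw [hc, Matrix.mulVec_mulVec, Matrix.mul_nonsing_inv _ hu, Matrix.one_mulVec]
    have hx : ∀ x : Fin n → ℤ, quadValue f (toReal x - c) =
        latticeDefect x f + quadValue f c := by
      intro x
      rw [latticeDefect_apply, quadValue_sub_vec hs, hfc]
      simp only [dotProduct, Finset.mul_sum]
      congr 2
      exact Finset.sum_congr rfl fun i _ => by ring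
    refine ⟨c, quadValue f c, fun x => ?_, ?_, ?_⟩
    · rw [hx]; linarith [(h x).1]
    · ext x
      rw [Set.mem_ofPred_eq, hx, (h x).2]
      constructor <;> intro h <;> linarith
    · have hmem : (0 : Fin n → ℝ) ∈ toReal '' V := ⟨0, h0, toReal_eq_zero.2 rfl⟩
      have h1 := affineSpan_insert_zero (k := ℝ) (toReal '' V)
      rw [Set.insert_eq_of_mem hmem] at h1
      have h2 : Submodule.span ℝ (toReal '' V) = ⊤ := by
        rw [eq_top_iff, ← (Pi.basisFun ℝ (Fin n)).span_eq]
        refine Submodule.span_mono ?_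
        rintro _ ⟨i, rfl⟩
        exact ⟨_, hV i, by rw [toReal_single]; simp⟩
      rw [h2] at h1
      exact SetLike.coe_injective (by rw [h1]; rfl)

end Delaunay

/-! ### TW(n) as a simplicial cone, its dimension and relative interior. -/

section TameWall

variable {m : ℕ}

theorem zero_mem_repartitioningComplex : 0 ∈ repartitioningComplex (m + 1) :=
  mem_repartitioningComplex.2 (Or.inl rfl)

theorem single_mem_repartitioningComplex (i : Fin (m + 1)) :
    Pi.single i 1 ∈ repartitioningComplex (m + 1) := by
  rw [mem_repartitioningComplex]
  refine Fin.lastCases ?_ (fun i => ?_) i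
  · exact Or.inr (Or.inr (Or.inl rfl))
  · exact Or.inr (Or.inl ⟨i, rfl⟩)

theorem dualGenerator_mem (k : Fin m ⊕ Sym2 (Fin m)) :
    dualGenerator k ∈ zeroOneDual (repartitioningComplex (m + 1)) :=
  mem_zeroOneDual_iff.2 (Or.inr ⟨k, rfl⟩)

theorem tameWall_eq_hull_range :
    tameWall (m + 1) = PointedCone.hull ℝ
      (Set.range fun k : Fin m ⊕ Sym2 (Fin m) => voronoiImage (dualGenerator k)) := by
  have h : tameWall (m + 1) = voronoiCone (Set.range (dualGenerator (m := m))) := by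
    apply le_antisymm
    · refine voronoiCone_le fun v hv => ?_
      rcases mem_zeroOneDual_iff.1 hv with h | ⟨k, rfl⟩
      · exact Or.inl h
      · exact Or.inr (Or.inl ⟨k, rfl⟩)
    · refine voronoiCone_le ?_
      rintro _ ⟨k, rfl⟩
      exact Or.inr (Or.inl (dualGenerator_mem k))
  rw [h, voronoiCone, ← Set.range_comp]
  rfl

/-- The coordinate functionals of the generators of the simplicial cone `TW(n)`. -/
noncomputable def tameCoordinate (k : Fin m ⊕ Sym2 (Fin m)) :
    Matrix (Fin (m + 1)) (Fin (m + 1)) ℝ →ₗ[ℝ] ℝ :=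
  (1 / 2 : ℝ) • latticeDefect (dualTest k)

/-- The polynomial a² - a takes the value 2 at both -1 and 2, which explains the factor 1/2, and
vanishes at 0 and 1. -/
theorem tameCoordinate_voronoiImage (k l : Fin m ⊕ Sym2 (Fin m)) :
    tameCoordinate k (voronoiImage (dualGenerator l)) = if k = l then 1 else 0 := by
  rw [tameCoordinate, LinearMap.smul_apply,
    latticeDefect_voronoiImage single_mem_repartitioningComplex (dualGenerator_mem l), smul_eq_mul]
  split_ifs with h
  · subst h
    rcases dualGenerator_dotProduct_dualTest_self k with h | h <;> rw [h] <;> norm_num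
  · rcases dualGenerator_dotProduct_dualTest_of_ne (Ne.symm h) with h | h <;> rw [h] <;> norm_num

theorem tameCoordinate_sum (c : Fin m ⊕ Sym2 (Fin m) → ℝ) (k : Fin m ⊕ Sym2 (Fin m)) :
    tameCoordinate k (∑ l, c l • voronoiImage (dualGenerator l)) = c k := by
  simp [map_sum, tameCoordinate_voronoiImage, -Fintype.sum_sum_type]

theorem linearIndependent_tameGenerators :
    LinearIndependent ℝ fun k : Fin m ⊕ Sym2 (Fin m) => voronoiImage (dualGenerator k) := by
  rw [Fintype.linearIndependent_iff]
  intro c hc k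
  rw [← tameCoordinate_sum c k, hc, map_zero]

theorem span_tameWall :
    Submodule.span ℝ (tameWall (m + 1) : Set (Matrix (Fin (m + 1)) (Fin (m + 1)) ℝ)) =
      Submodule.span ℝ
        (Set.range fun k : Fin m ⊕ Sym2 (Fin m) => voronoiImage (dualGenerator k)) := by
  rw [tameWall_eq_hull_range]
  exact le_antisymm (Submodule.span_le.2 (PointedCone.hull_le_span _ _))
    (Submodule.span_mono PointedCone.subset_hull)

/-- The independent generators number m plus the binomial coefficient of m+1 over 2; Pascal's rule
shows this is one less than that of m+2 over 2. -/
theorem coneDim_tameWall : coneDim (tameWall (m + 1)) + 1 = (m + 1) * (m + 1 + 1) / 2 := by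
  rw [coneDim, span_tameWall, finrank_span_eq_card linearIndependent_tameGenerators,
    Fintype.card_sum, Sym2.card, Fintype.card_fin]
  have h : (m + 1 + 1).choose 2 = (m + 1).choose 1 + (m + 1).choose 2 :=
    Nat.choose_succ_succ (m + 1) 1
  have h2 := Nat.choose_two_right (m + 1 + 1)
  rw [Nat.choose_one_right] at h
  rw [Nat.add_sub_cancel, mul_comm] at h2
  rw [← h2]
  omega

/-- The span of `TW(n)` consists of the symmetric matrices for which the last vertex of the big
simplex lies on the ellipsoid through the other ones. -/
theorem span_tameGenerators (hm : 4 ≤ m) :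
    Submodule.span ℝ
      (Set.range fun k : Fin m ⊕ Sym2 (Fin m) => voronoiImage (dualGenerator k)) =
    symmetricMatrices (m + 1) ⊓ LinearMap.ker
      (latticeDefect (Fin.snoc (α := fun _ => ℤ) (fun _ : Fin m => 1) (2 - (m : ℤ)))) := by
  -- At the square of the last coordinate the functional equals (m-2)² + (m-2), so it is not zero on
  -- symmetric matrices and the dimensions match.
  refine inf_ker_eq_of_finrank ?_ ?_ ?_ ⟨voronoiImage (Pi.single (Fin.last m) 1),
    voronoiImage_isSymm _, ?_⟩
  · rw [Submodule.span_le]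
    rintro _ ⟨k, rfl⟩
    exact voronoiImage_isSymm _
  · rw [finrank_symmetricMatrices, ← span_tameWall]
    exact coneDim_tameWall
  · intro u hu
    induction hu using Submodule.span_induction with
    | zero => simp
    | add x y _ _ hx hy => simp [hx, hy]
    | smul a x _ hx => simp [hx]
    | mem x h =>
      obtain ⟨k, rfl⟩ := h
      rw [latticeDefect_voronoiImage single_mem_repartitioningComplex (dualGenerator_mem k)]
      rcases dualGenerator_mem k _ (mem_repartitioningComplex.2 (Or.inr (Or.inr (Or.inr rfl))))
        with h | h <;> rw [h] <;> norm_num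
  · rw [latticeDefect_apply, quadValue_voronoiImage, toReal_dotProduct]
    simp [Fin.sum_univ_castSucc, voronoiImage, Matrix.vecMulVec_apply, toReal]
    have : (4 : ℝ) ≤ m := by exact_mod_cast hm
    intro h
    nlinarith

/-- The relative interior of `TW(n)` is the set of positive definite forms for which the
repartitioning complex is a Delaunay cell. -/
theorem intrinsicInterior_tameWall (hm : 4 ≤ m) :
    intrinsicInterior ℝ (tameWall (m + 1) : Set (Matrix (Fin (m + 1)) (Fin (m + 1)) ℝ)) =
      {f | f.PosDef ∧ IsDelaunayCell f (repartitioningComplex (m + 1))} := by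
  rw [tameWall_eq_hull_range, intrinsicInterior_hull_range _ tameCoordinate
    (fun k => (continuous_latticeDefect _).const_smul (1 / 2 : ℝ)) tameCoordinate_voronoiImage]
  ext f
  constructor
  · rintro ⟨hf, hpos⟩
    obtain ⟨c, rfl⟩ := (Submodule.mem_span_range_iff_exists_fun ℝ).1 hf
    have hc : ∀ k, 0 < c k := by
      intro k
      simpa only [tameCoordinate_sum] using hpos k
    have hq : ∀ x : Fin (m + 1) → ℝ,
        quadValue (∑ k, c k • voronoiImage (dualGenerator k)) x =
          ∑ k, c k * (toReal (dualGenerator k) ⬝ᵥ x) ^ 2 := by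
      intro x
      simp only [← quadValue_voronoiImage]
      simp [quadValue, Matrix.sum_mulVec, dotProduct_sum, Matrix.smul_mulVec, -Fintype.sum_sum_type]
    have hpd : (∑ k, c k • voronoiImage (dualGenerator k)).PosDef := by
      refine posDef_of_quadValue_pos ?_ fun x hx => ?_
      · exact Submodule.sum_mem (symmetricMatrices (m + 1)) fun k _ =>
          (voronoiImage_isSymm _).smul _
      rw [hq]
      have hnn : ∀ k ∈ Finset.univ, 0 ≤ c k * (toReal (dualGenerator k) ⬝ᵥ x) ^ 2 :=
        fun k _ => mul_nonneg (hc k).le (sq_nonneg _)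
      refine lt_of_le_of_ne (Finset.sum_nonneg hnn) fun h0 => hx ?_
      -- The generators span the space: the unit vectors kill the first m coordinates of x, and one
      -- vector with last coordinate 1 then kills the last.
      have h1 : ∀ k, toReal (dualGenerator k) ⬝ᵥ x = 0 := by
        intro k
        have := (Finset.sum_eq_zero_iff_of_nonneg hnn).1 h0.symm k (Finset.mem_univ k)
        simpa [(hc k).ne'] using this
      have h2 : ∀ i : Fin m, x i.castSucc = 0 := fun i => by
        rw [← toReal_dualGenerator_dotProduct_inl i x, h1]
      have h3 := h1 (.inr s(⟨0, by omega⟩, ⟨0, by omega⟩))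
      rw [toReal_dualGenerator_dotProduct_inr, Fin.sum_univ_castSucc] at h3
      simp only [h2, Finset.sum_const_zero, zero_add, sub_zero, if_true] at h3
      ext i
      exact Fin.lastCases h3 h2 i
    refine ⟨hpd, (isDelaunayCell_iff hpd zero_mem_repartitioningComplex
      single_mem_repartitioningComplex).2 fun x => ?_⟩
    rw [map_sum]
    simp only [map_smul, smul_eq_mul,
      latticeDefect_voronoiImage single_mem_repartitioningComplex (dualGenerator_mem _)]
    have hint : ∀ a : ℤ, (0 : ℝ) ≤ (a : ℝ) ^ 2 - a := by
      intro a
      have : 0 ≤ a ^ 2 - a := by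
        rcases le_or_gt a 0 with h | h <;> nlinarith
      exact_mod_cast this
    have hnn : ∀ k ∈ Finset.univ, (0 : ℝ) ≤ c k * (((dualGenerator k ⬝ᵥ x : ℤ) : ℝ) ^ 2 -
        ((dualGenerator k ⬝ᵥ x : ℤ) : ℝ)) := fun k _ => mul_nonneg (hc k).le (hint _)
    refine ⟨Finset.sum_nonneg hnn, ?_⟩
    rw [Finset.sum_eq_zero_iff_of_nonneg hnn, ← forall_dualGenerator_dotProduct_iff hm]
    refine forall_congr' fun k => ?_
    have : ((dualGenerator k ⬝ᵥ x : ℤ) : ℝ) ^ 2 - ((dualGenerator k ⬝ᵥ x : ℤ) : ℝ) =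
        ((dualGenerator k ⬝ᵥ x : ℤ) : ℝ) * (((dualGenerator k ⬝ᵥ x : ℤ) : ℝ) - 1) := by ring
    rw [this]
    simp only [Finset.mem_univ, forall_true_left, mul_eq_zero, (hc k).ne', false_or, sub_eq_zero]
    norm_cast
  · rintro ⟨hpd, hdel⟩
    rw [isDelaunayCell_iff hpd zero_mem_repartitioningComplex single_mem_repartitioningComplex]
      at hdel
    refine ⟨?_, fun k => ?_⟩
    · rw [span_tameGenerators hm]
      exact ⟨isSymm_of_posDef hpd, (hdel _).2.1 (mem_repartitioningComplex.2
        (Or.inr (Or.inr (Or.inr rfl))))⟩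
    -- A vanishing coordinate would put the test point in R_n, where every generator has product 0
    -- or 1; its own generator has product -1 or 2.
    · refine mul_pos (by norm_num) (lt_of_le_of_ne (hdel _).1 fun h0 => ?_)
      have := dualGenerator_mem k _ ((hdel _).2.2 h0.symm)
      rcases dualGenerator_dotProduct_dualTest_self k with h | h <;> rw [h] at this <;> omega

end TameWall

/-! ### The orthogonal frame identifying ℤⁿ with the root lattice D_n. -/

section Coordinates

variable {m : ℕ} {R : Type*} [CommRing R]

/-- The first `m` coordinates of a vector with respect to the orthogonal frame adapted to the
root lattice `D`. -/
def frameCoord (v : Fin (m + 1) → R) (i : Fin m) : R := v i.castSucc - v (Fin.last m)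

/-- The last coordinate of a vector with respect to the orthogonal frame adapted to the root
lattice `D`. -/
def frameLast (v : Fin (m + 1) → R) : R := ∑ i, frameCoord v i + 2 * v (Fin.last m)

theorem sum_frameCoord (v : Fin (m + 1) → R) :
    ∑ i, frameCoord v i = ∑ i : Fin m, v i.castSucc - m * v (Fin.last m) := by
  simp [frameCoord]

theorem sum_frameCoord_sq (v : Fin (m + 1) → R) :
    ∑ i, frameCoord v i ^ 2 = ∑ i : Fin m, v i.castSucc ^ 2 -
      2 * v (Fin.last m) * ∑ i : Fin m, v i.castSucc + m * v (Fin.last m) ^ 2 := by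
  simp only [frameCoord, sub_sq, Finset.sum_add_distrib, Finset.sum_sub_distrib, Finset.mul_sum]
  simp
  exact Finset.sum_congr rfl fun i _ => by ring

theorem frameCoord_neg (v : Fin (m + 1) → R) (i : Fin m) : frameCoord (-v) i = -frameCoord v i := by
  simp [frameCoord]; ring

theorem sum_frameCoord_neg (v : Fin (m + 1) → R) :
    ∑ i, frameCoord (-v) i = -∑ i, frameCoord v i := by
  simp [frameCoord_neg]

theorem frameLast_neg (v : Fin (m + 1) → R) : frameLast (-v) = -frameLast v := by
  simp only [frameLast, sum_frameCoord_neg, Pi.neg_apply]; ring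

theorem frameCoord_toReal (v : Fin (m + 1) → ℤ) (i : Fin m) :
    frameCoord (toReal v) i = ((frameCoord v i : ℤ) : ℝ) := by
  simp [frameCoord, toReal]

theorem frameLast_toReal (v : Fin (m + 1) → ℤ) : frameLast (toReal v) = ((frameLast v : ℤ) : ℝ) := by
  simp [frameLast, frameCoord_toReal, toReal]

theorem eq_zero_of_frame [CharZero R] [NoZeroDivisors R] {v : Fin (m + 1) → R}
    (h : ∀ i, frameCoord v i = 0) (h0 : frameLast v = 0) : v = 0 := by
  have hl : v (Fin.last m) = 0 := by simpa [frameLast, h] using h0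
  ext i
  refine Fin.lastCases hl (fun i => ?_) i
  simpa [frameCoord, hl] using h i

/-- The vector with given frame coordinates and given last standard coordinate. -/
def ofFrame (x : Fin m → R) (b : R) : Fin (m + 1) → R :=
  Fin.snoc (α := fun _ => R) (fun i => x i + b) b

theorem frameCoord_ofFrame (x : Fin m → R) (b : R) : frameCoord (ofFrame x b) = x := by
  ext i; simp [frameCoord, ofFrame]

theorem ofFrame_last (x : Fin m → R) (b : R) : ofFrame x b (Fin.last m) = b := by
  simp [ofFrame]

theorem frameLast_ofFrame (x : Fin m → R) (b : R) :
    frameLast (ofFrame x b) = ∑ i, x i + 2 * b := by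
  rw [frameLast, frameCoord_ofFrame, ofFrame_last]

theorem ofFrame_frameCoord (v : Fin (m + 1) → R) :
    ofFrame (frameCoord v) (v (Fin.last m)) = v := by
  ext i
  refine Fin.lastCases ?_ (fun i => ?_) i <;> simp [ofFrame, frameCoord]

end Coordinates

/-! ### TF_n in the frame, and the integer inequality for its minimum. -/

section TameForm

variable {m : ℕ}

/-- The largest even number not exceeding `m`. -/
def evenPart (m : ℕ) : ℕ := 2 * (m / 2)

theorem evenPart_of_even (h : Even m) : evenPart m = m := by
  obtain ⟨k, rfl⟩ := h; unfold evenPart; omega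

theorem evenPart_of_odd (h : Odd m) : evenPart m + 1 = m := by
  obtain ⟨k, rfl⟩ := h; unfold evenPart; omega

theorem quadValue_of_blocks {f : Matrix (Fin (m + 1)) (Fin (m + 1)) ℝ} {a b d : ℝ}
    (h1 : ∀ i j : Fin m, f i.castSucc j.castSucc = if i = j then 1 else a)
    (h2 : ∀ i : Fin m, f i.castSucc (Fin.last m) = b)
    (h3 : ∀ i : Fin m, f (Fin.last m) i.castSucc = b) (h4 : f (Fin.last m) (Fin.last m) = d)
    (z : Fin (m + 1) → ℝ) :
    quadValue f z = (1 - a) * ∑ i : Fin m, z i.castSucc ^ 2 + a * (∑ i : Fin m, z i.castSucc) ^ 2 +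
      2 * b * z (Fin.last m) * ∑ i : Fin m, z i.castSucc + d * z (Fin.last m) ^ 2 := by
  have hij : ∀ i j : Fin m, (if i = j then (1 : ℝ) else a) * (z i.castSucc * z j.castSucc) =
      (if i = j then (1 - a) * (z i.castSucc * z j.castSucc) else 0) +
        a * (z i.castSucc * z j.castSucc) := by
    intro i j; split_ifs <;> ring
  rw [quadValue_eq_sum]
  simp only [Fin.sum_univ_castSucc, h1, h2, h3, h4, hij, Finset.sum_add_distrib,
    Finset.sum_ite_eq, Finset.mem_univ, if_true]
  have e1 : ∑ i : Fin m, (1 - a) * (z i.castSucc * z i.castSucc) =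
      (1 - a) * ∑ i : Fin m, z i.castSucc ^ 2 := by
    rw [Finset.mul_sum]; exact Finset.sum_congr rfl fun i _ => by ring
  have e2 : ∑ i : Fin m, ∑ j : Fin m, a * (z i.castSucc * z j.castSucc) =
      a * (∑ i : Fin m, z i.castSucc) ^ 2 := by
    rw [sq, Finset.sum_mul_sum, Finset.mul_sum]
    exact Finset.sum_congr rfl fun i _ => by rw [Finset.mul_sum]
  have e3 : ∑ i : Fin m, b * (z i.castSucc * z (Fin.last m)) =
      b * z (Fin.last m) * ∑ i : Fin m, z i.castSucc := by
    rw [Finset.mul_sum]; exact Finset.sum_congr rfl fun i _ => by ring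
  have e4 : ∑ i : Fin m, b * (z (Fin.last m) * z i.castSucc) =
      b * z (Fin.last m) * ∑ i : Fin m, z i.castSucc := by
    rw [Finset.mul_sum]; exact Finset.sum_congr rfl fun i _ => by ring
  rw [e1, e2, e3, e4]
  ring

theorem four_le_evenPart (hm : 4 ≤ m) : 4 ≤ evenPart m := by unfold evenPart; omega

theorem formTF_isSymm (n : ℕ) : (formTF n).IsSymm := by
  ext i j
  simp only [formTF, Matrix.transpose_apply, Matrix.of_apply, and_comm, eq_comm]

/-- The form `TFₙ` in the orthogonal frame. -/
theorem quadValue_formTF (hm : 4 ≤ m) (z : Fin (m + 1) → ℝ) :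
    2 * (evenPart m : ℝ) * quadValue (formTF (m + 1)) z =
      (evenPart m - 1) * frameLast z ^ 2 + (evenPart m + 2) * ∑ i, frameCoord z i ^ 2 -
        (∑ i, frameCoord z i) ^ 2 := by
  have hm' : (4 : ℝ) ≤ m := by exact_mod_cast hm
  rw [frameLast, sum_frameCoord_sq, sum_frameCoord]
  -- Since n = m+1, even m corresponds to the odd-n formulas; a, b, d are the entries of TF_n
  -- rewritten in m.
  rcases Nat.even_or_odd m with h | h
  · have hn : ¬ Even (m + 1) := by simpa [Nat.even_add_one] using h
    rw [evenPart_of_even h, quadValue_of_blocks (f := formTF (m + 1)) (a := ((m : ℝ) - 2) / (2 * m))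
      (b := -(((m : ℝ) ^ 2 - 3 * m + 4) / (2 * m)))
      (d := ((m : ℝ) ^ 3 - 5 * m ^ 2 + 10 * m - 4) / (2 * m))]
    · field_simp
      ring
    all_goals intros
    all_goals simp [formTF, hn, (Fin.castSucc_lt_last _).ne, (Fin.castSucc_lt_last _).ne']
    all_goals ring_nf
  · have hn : Even (m + 1) := by simpa [Nat.even_add_one] using h
    have hK : (evenPart m : ℝ) = m - 1 := by
      rw [eq_sub_iff_add_eq]; exact_mod_cast evenPart_of_odd h
    rw [hK, quadValue_of_blocks (f := formTF (m + 1)) (a := ((m : ℝ) - 3) / (2 * (m - 1)))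
      (b := -(((m : ℝ) ^ 2 - 4 * m + 5) / (2 * (m - 1))))
      (d := (1 / 2) * (m : ℝ) ^ 2 - (5 / 2) * m + 4)]
    · have : (m : ℝ) - 1 ≠ 0 := by linarith
      field_simp
      ring
    all_goals intros
    all_goals simp [formTF, hn, (Fin.castSucc_lt_last _).ne, (Fin.castSucc_lt_last _).ne']
    all_goals ring_nf

/-- Cauchy–Schwarz together with m ≤ K+1. It bounds 2K·TF_n below by (K-1)t² + p, which yields
positive definiteness. -/
theorem sq_sum_frameCoord_le (z : Fin (m + 1) → ℝ) :
    (∑ i, frameCoord z i) ^ 2 ≤ (evenPart m + 1) * ∑ i, frameCoord z i ^ 2 := by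
  have h := sq_sum_le_card_mul_sum_sq (s := Finset.univ) (f := frameCoord z)
  rw [Finset.card_univ, Fintype.card_fin] at h
  refine h.trans (mul_le_mul_of_nonneg_right ?_ (Finset.sum_nonneg fun i _ => sq_nonneg _))
  have : m ≤ evenPart m + 1 := by unfold evenPart; omega
  exact_mod_cast this

theorem formTF_posDef (hm : 4 ≤ m) : (formTF (m + 1)).PosDef := by
  refine posDef_of_quadValue_pos (formTF_isSymm _) fun z hz => ?_
  have hK : (4 : ℝ) ≤ evenPart m := by exact_mod_cast four_le_evenPart hm
  have h1 := quadValue_formTF hm z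
  have h2 := sq_sum_frameCoord_le z
  have hp : 0 ≤ ∑ i, frameCoord z i ^ 2 := Finset.sum_nonneg fun i _ => sq_nonneg _
  by_contra hneg
  push Not at hneg
  have h3 : 2 * (evenPart m : ℝ) * quadValue (formTF (m + 1)) z ≤ 0 :=
    mul_nonpos_of_nonneg_of_nonpos (by linarith) hneg
  have h4 : 0 ≤ ((evenPart m : ℝ) - 1) * frameLast z ^ 2 :=
    mul_nonneg (by linarith) (sq_nonneg _)
  have hp0 : ∑ i, frameCoord z i ^ 2 = 0 := by linarith
  have ht0 : ((evenPart m : ℝ) - 1) * frameLast z ^ 2 = 0 := by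
    refine le_antisymm ?_ h4
    rw [hp0] at h1 h2
    linarith
  refine hz (eq_zero_of_frame (fun i => ?_) ?_)
  · simpa using (Finset.sum_eq_zero_iff_of_nonneg fun i _ => sq_nonneg _).1 hp0 i
      (Finset.mem_univ i)
  · have : (evenPart m : ℝ) - 1 ≠ 0 := by linarith
    simpa [this] using ht0

/-- The numerical estimate behind the minimum of `TFₙ`. -/
theorem two_mul_le_and_eq_cases {K s t p : ℤ} (hK : 4 ≤ K) (hKe : Even K) (hs : 0 ≤ s) (ht : 0 ≤ t)
    (hsp : s ≤ p) (hsp3 : 3 * s - 2 * (K + 1) ≤ p) (hcs : s ^ 2 ≤ (K + 1) * p)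
    (hpar : Even (p - s)) (htpar : Even (t - s)) (hne : t ≠ 0 ∨ p ≠ 0) :
    2 * K ≤ (K - 1) * t ^ 2 + (K + 2) * p - s ^ 2 ∧
      ((K - 1) * t ^ 2 + (K + 2) * p - s ^ 2 = 2 * K → p = s ∧
        ((t = 0 ∧ (s = 2 ∨ s = K)) ∨ (t = 1 ∧ (s = 1 ∨ s = K + 1)))) := by
  obtain ⟨k, rfl⟩ := hKe
  obtain ⟨a, ha⟩ := hpar
  obtain ⟨b, hb⟩ := htpar
  set K := k + k with hKdef
  -- For s ≤ 2K+2 the bound p ≥ 3s - 2(K+1) leaves (s-(K+2))(2K+2-s) ≥ 0. Beyond that,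
  -- Cauchy–Schwarz gives p ≥ 2s and (K+2)p - s² ≥ p.
  have hlarge : K + 1 < s → 2 * s ≤ (K + 2) * p - s ^ 2 := by
    intro h
    rcases le_or_gt s (2 * K + 2) with h' | h'
    · nlinarith [mul_le_mul_of_nonneg_left hsp3 (show 0 ≤ K + 2 by linarith),
        mul_nonneg (show 0 ≤ s - (K + 2) by linarith) (sub_nonneg.2 h')]
    · have : 2 * s ≤ p := by
        by_contra hc
        push Not at hc
        nlinarith [mul_lt_mul_of_pos_left hc (show 0 < K + 1 by linarith)]
      linarith
  rcases lt_trichotomy t 1 with h | h | h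
  · obtain rfl : t = 0 := by omega
    simp only [zero_ne_one, false_and, or_false, true_and]
    rcases le_or_gt s (K + 1) with h1 | h1
    · have hsK : s ≤ K := by omega
      rcases eq_or_lt_of_le hs with h0 | h0
      · subst h0
        have : 2 ≤ p := by omega
        constructor
        · nlinarith
        · intro h; nlinarith
      · have hs2 : 2 ≤ s := by omega
        -- The excess over 2K is (s-2)(K-s) + (K+2)(p-s), so equality forces p = s and s at an end
        -- of the interval.
        have h3 := mul_nonneg (sub_nonneg.2 hs2) (sub_nonneg.2 hsK)
        have h4 := mul_nonneg (show 0 ≤ K + 2 by linarith) (sub_nonneg.2 hsp)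
        constructor
        · nlinarith
        · intro h
          have h5 : (s - 2) * (K - s) = 0 := by nlinarith
          have h6 : (K + 2) * (p - s) = 0 := by nlinarith
          refine ⟨?_, ?_⟩
          · rcases mul_eq_zero.1 h6 with h | h <;> omega
          · rcases mul_eq_zero.1 h5 with h | h <;> omega
    · have := hlarge h1
      constructor
      · nlinarith
      · intro h; nlinarith
  · subst h
    simp only [one_ne_zero, false_and, false_or, true_and]
    rcases le_or_gt s (K + 1) with h1 | h1
    · have hs1 : 1 ≤ s := by omega
      -- For t = 1 the excess over 2K is (s-1)(K+1-s) + (K+2)(p-s).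
      have h3 := mul_nonneg (sub_nonneg.2 hs1) (sub_nonneg.2 h1)
      have h4 := mul_nonneg (show 0 ≤ K + 2 by linarith) (sub_nonneg.2 hsp)
      constructor
      · nlinarith
      · intro h
        have h5 : (s - 1) * (K + 1 - s) = 0 := by nlinarith
        have h6 : (K + 2) * (p - s) = 0 := by nlinarith
        refine ⟨?_, ?_⟩
        · rcases mul_eq_zero.1 h6 with h | h <;> omega
        · rcases mul_eq_zero.1 h5 with h | h <;> omega
    · have := hlarge h1
      constructor
      · nlinarith
      · intro h; nlinarith
  -- For t ≥ 2 the first term is at least 4(K-1) > 2K, and the rest is nonnegative by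
  -- Cauchy–Schwarz.
  · have h4 : 4 ≤ t ^ 2 := by nlinarith
    have h5 := mul_le_mul_of_nonneg_left h4 (show 0 ≤ K - 1 by linarith)
    have h6 : 0 ≤ p := hs.trans hsp
    constructor
    · nlinarith
    · intro h; nlinarith

end TameForm

/-! ### The minimum of TF_n, and the dual of R_n in frame coordinates. -/

section MinimalVectors

variable {m : ℕ}

theorem sum_frameCoord_sq_toReal (v : Fin (m + 1) → ℤ) :
    ∑ i, frameCoord (toReal v) i ^ 2 = ((∑ i, frameCoord v i ^ 2 : ℤ) : ℝ) := by
  simp [frameCoord_toReal]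

theorem sum_frameCoord_toReal (v : Fin (m + 1) → ℤ) :
    ∑ i, frameCoord (toReal v) i = ((∑ i, frameCoord v i : ℤ) : ℝ) := by
  simp [frameCoord_toReal]

theorem quadValue_formTF_toReal (hm : 4 ≤ m) (v : Fin (m + 1) → ℤ) :
    2 * (evenPart m : ℝ) * quadValue (formTF (m + 1)) (toReal v) =
      (((evenPart m - 1) * frameLast v ^ 2 + (evenPart m + 2) * ∑ i, frameCoord v i ^ 2 -
        (∑ i, frameCoord v i) ^ 2 : ℤ) : ℝ) := by
  rw [quadValue_formTF hm, frameLast_toReal, sum_frameCoord_sq_toReal, sum_frameCoord_toReal]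
  push_cast
  rfl

theorem sum_le_sum_sq (x : Fin m → ℤ) : ∑ i, x i ≤ ∑ i, x i ^ 2 :=
  Finset.sum_le_sum fun i _ => by
    rcases le_or_gt (x i) 0 with h | h <;> nlinarith

/-- Summing (a-1)(a-2) ≥ 0, valid at integers, improves on p ≥ s when the coordinates are larger
than 1 on average. -/
theorem three_mul_sum_le (x : Fin m → ℤ) : 3 * ∑ i, x i - 2 * m ≤ ∑ i, x i ^ 2 := by
  have : ∑ i, (3 * x i - 2) ≤ ∑ i, x i ^ 2 := Finset.sum_le_sum fun i _ => by
    rcases le_or_gt (x i) 1 with h | h <;> nlinarith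
  rw [Finset.sum_sub_distrib, ← Finset.mul_sum] at this
  simpa [mul_comm] using this

theorem even_sum_sq_sub_sum (x : Fin m → ℤ) : Even (∑ i, x i ^ 2 - ∑ i, x i) := by
  rw [← Finset.sum_sub_distrib]
  refine Finset.even_sum _ fun i _ => ?_
  rw [show x i ^ 2 - x i = x i * (x i - 1) by ring]
  exact Int.even_mul_pred_self _

theorem even_evenPart (m : ℕ) : Even (evenPart m) := even_two_mul _

theorem frame_ne_zero {v : Fin (m + 1) → ℤ} (hv : v ≠ 0) :
    frameLast v ≠ 0 ∨ ∑ i, frameCoord v i ^ 2 ≠ 0 := by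
  by_contra! h
  refine hv (eq_zero_of_frame (fun i => ?_) h.1)
  simpa using (Finset.sum_eq_zero_iff_of_nonneg fun i _ => sq_nonneg _).1 h.2 i
    (Finset.mem_univ i)

theorem even_frameLast_sub (v : Fin (m + 1) → ℤ) : Even (frameLast v - ∑ i, frameCoord v i) := by
  rw [frameLast, add_sub_cancel_left]; exact even_two_mul _

theorem even_abs_sub_abs {a b : ℤ} (h : Even (a - b)) : Even (|a| - |b|) := by
  rwa [Int.even_sub, even_abs, even_abs, ← Int.even_sub]

/-- The minimum of the integral form proportional to `TFₙ`, and the vectors attaining it. -/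
theorem formTF_frame_estimate (hm : 4 ≤ m) {v : Fin (m + 1) → ℤ} (hv : v ≠ 0) :
    2 * (evenPart m : ℤ) ≤ (evenPart m - 1) * frameLast v ^ 2 +
        (evenPart m + 2) * ∑ i, frameCoord v i ^ 2 - (∑ i, frameCoord v i) ^ 2 ∧
      ((evenPart m - 1) * frameLast v ^ 2 + (evenPart m + 2) * ∑ i, frameCoord v i ^ 2 -
          (∑ i, frameCoord v i) ^ 2 = 2 * (evenPart m : ℤ) →
        ∑ i, frameCoord v i ^ 2 = |∑ i, frameCoord v i| ∧
          ((|frameLast v| = 0 ∧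
              (|∑ i, frameCoord v i| = 2 ∨ |∑ i, frameCoord v i| = evenPart m)) ∨
            (|frameLast v| = 1 ∧
              (|∑ i, frameCoord v i| = 1 ∨ |∑ i, frameCoord v i| = evenPart m + 1)))) := by
  have hmK : (m : ℤ) ≤ evenPart m + 1 := by
    have : m ≤ evenPart m + 1 := by unfold evenPart; omega
    exact_mod_cast this
  have hneg : ∑ i, (-frameCoord v i) ^ 2 = ∑ i, frameCoord v i ^ 2 := by simp
  have h1 := sum_le_sum_sq (frameCoord v)
  have h2 := sum_le_sum_sq fun i => -frameCoord v i
  have h3 := three_mul_sum_le (frameCoord v)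
  have h4 := three_mul_sum_le fun i => -frameCoord v i
  have h5 := even_sum_sq_sub_sum (frameCoord v)
  rw [hneg, Finset.sum_neg_distrib] at h2 h4
  have hcs := sq_sum_le_card_mul_sum_sq (s := Finset.univ) (f := frameCoord v)
  rw [Finset.card_univ, Fintype.card_fin] at hcs
  have hp : 0 ≤ ∑ i, frameCoord v i ^ 2 := Finset.sum_nonneg fun i _ => sq_nonneg _
  have h6 := two_mul_le_and_eq_cases (K := evenPart m) (s := |∑ i, frameCoord v i|)
    (t := |frameLast v|) (p := ∑ i, frameCoord v i ^ 2)
    (by exact_mod_cast four_le_evenPart hm) (by exact_mod_cast even_evenPart m)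
    (abs_nonneg _) (abs_nonneg _) (abs_le'.2 ⟨h1, h2⟩)
    (by rcases abs_choice (∑ i, frameCoord v i) with h | h <;> rw [h] <;> linarith)
    (by rw [sq_abs]; exact hcs.trans (mul_le_mul_of_nonneg_right hmK hp))
    (by have := even_abs_sub_abs h5; rwa [abs_of_nonneg hp] at this)
    (even_abs_sub_abs (even_frameLast_sub v))
    (by rw [Ne, abs_eq_zero]; exact frame_ne_zero hv)
  simpa only [sq_abs] using h6

theorem quadValue_formTF_eq_one_iff (hm : 4 ≤ m) (v : Fin (m + 1) → ℤ) :
    quadValue (formTF (m + 1)) (toReal v) = 1 ↔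
      (evenPart m - 1) * frameLast v ^ 2 + (evenPart m + 2) * ∑ i, frameCoord v i ^ 2 -
          (∑ i, frameCoord v i) ^ 2 = 2 * (evenPart m : ℤ) := by
  have h := quadValue_formTF_toReal hm v
  have hK : (4 : ℝ) ≤ evenPart m := by exact_mod_cast four_le_evenPart hm
  rw [← @Int.cast_inj ℝ, ← h]
  push_cast
  constructor
  · intro h; rw [h, mul_one]
  · intro h
    exact mul_left_cancel₀ (show 2 * (evenPart m : ℝ) ≠ 0 by linarith) (by rw [h, mul_one])

theorem forall_eq_zero_or_neg_one {x : Fin m → ℤ} (h : ∑ i, x i ^ 2 = -∑ i, x i) (i : Fin m) :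
    x i = 0 ∨ x i = -1 := by
  rw [← sub_eq_zero, sub_neg_eq_add, ← Finset.sum_add_distrib,
    Finset.sum_eq_zero_iff_of_nonneg] at h
  · have := h i (Finset.mem_univ i)
    have : x i * (x i + 1) = 0 := by linarith
    rcases mul_eq_zero.1 this with h | h <;> omega
  · intro i _
    rcases le_or_gt (x i) (-1) with h | h <;> nlinarith

/-- A vector of norm two of the root lattice `D` at which `TFₙ` attains its minimum belongs, up to
sign, to the `(0,1)`-dual of the repartitioning complex. -/
theorem neg_mem_zeroOneDual_or_mem {v : Fin (m + 1) → ℤ}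
    (h1 : frameLast v ^ 2 + ∑ i, frameCoord v i ^ 2 = 2)
    (h2 : 3 * frameLast v ^ 2 + (∑ i, frameCoord v i) ^ 2 = 4) :
    v ∈ zeroOneDual (repartitioningComplex (m + 1)) ∨
      -v ∈ zeroOneDual (repartitioningComplex (m + 1)) := by
  -- The sign is normalised to t = 1, or t = 0 with s < 0. What remains is x = e_i or -e_i with t =
  -- 1, or x = -e_i - e_j with t = 0. Moreover t is the product of v with (1,…,1,2-m), so one dual
  -- condition is read off from t.
  have key : ∀ v : Fin (m + 1) → ℤ, frameLast v ^ 2 + ∑ i, frameCoord v i ^ 2 = 2 →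
      3 * frameLast v ^ 2 + (∑ i, frameCoord v i) ^ 2 = 4 →
      (frameLast v = 1 ∨ (frameLast v = 0 ∧ ∑ i, frameCoord v i < 0)) →
      v ∈ zeroOneDual (repartitioningComplex (m + 1)) := by
    intro v h1 h2 h
    have hlast : frameLast v = ∑ i : Fin m, v i.castSucc + v (Fin.last m) * (2 - (m : ℤ)) := by
      rw [frameLast, sum_frameCoord]; ring
    have hb : frameLast v = ∑ i, frameCoord v i + 2 * v (Fin.last m) := rfl
    have hpos : (∑ i, frameCoord v i = ∑ i, frameCoord v i ^ 2) →
        ∀ i, frameCoord v i = 0 ∨ frameCoord v i = 1 := by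
      intro h i
      rw [eq_comm, ← sub_eq_zero, ← Finset.sum_sub_distrib,
        Finset.sum_eq_zero_iff_of_nonneg] at h
      · have := h i (Finset.mem_univ i)
        have : frameCoord v i * (frameCoord v i - 1) = 0 := by linarith
        rcases mul_eq_zero.1 this with h | h <;> omega
      · intro i _
        rcases le_or_gt (frameCoord v i) 0 with h | h <;> nlinarith
    rw [mem_zeroOneDual, ← hlast]
    rcases h with h | ⟨h, hs⟩
    · rw [h] at h1 h2 hb
      have hs : (∑ i, frameCoord v i - 1) * (∑ i, frameCoord v i + 1) = 0 := by linarith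
      rcases mul_eq_zero.1 hs with hs | hs
      · have hx := hpos (by linarith)
        have hl : v (Fin.last m) = 0 := by omega
        refine ⟨fun i => ?_, Or.inl hl, Or.inr h⟩
        have := hx i
        rw [frameCoord, hl] at this
        simpa using this
      · have hx := forall_eq_zero_or_neg_one (x := frameCoord v) (by linarith)
        have hl : v (Fin.last m) = 1 := by omega
        refine ⟨fun i => ?_, Or.inr hl, Or.inr h⟩
        have := hx i
        rw [frameCoord, hl] at this
        omega
    · rw [h] at h1 h2 hb
      have hs : (∑ i, frameCoord v i - 2) * (∑ i, frameCoord v i + 2) = 0 := by linarith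
      rcases mul_eq_zero.1 hs with hs | hs
      · omega
      · have hx := forall_eq_zero_or_neg_one (x := frameCoord v) (by linarith)
        have hl : v (Fin.last m) = 1 := by omega
        refine ⟨fun i => ?_, Or.inr hl, Or.inl h⟩
        have := hx i
        rw [frameCoord, hl] at this
        omega
  have ht : frameLast v ^ 2 ≤ 1 := by nlinarith [sq_nonneg (∑ i, frameCoord v i)]
  have ht1 : frameLast v = -1 ∨ frameLast v = 0 ∨ frameLast v = 1 := by
    have := abs_le.1 (sq_le_one_iff_abs_le_one _ |>.1 ht); omega
  have hn1 : frameLast (-v) ^ 2 + ∑ i, frameCoord (-v) i ^ 2 = 2 := by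
    simpa [frameLast_neg, frameCoord_neg] using h1
  have hn2 : 3 * frameLast (-v) ^ 2 + (∑ i, frameCoord (-v) i) ^ 2 = 4 := by
    rw [frameLast_neg, sum_frameCoord_neg, neg_sq, neg_sq]; exact h2
  rcases ht1 with h | h | h
  · exact Or.inr (key _ hn1 hn2 (Or.inl (by rw [frameLast_neg, h]; rfl)))
  · rcases lt_trichotomy (∑ i, frameCoord v i) 0 with hs | hs | hs
    · exact Or.inl (key _ h1 h2 (Or.inr ⟨h, hs⟩))
    · rw [h, hs] at h2; norm_num at h2
    · exact Or.inr (key _ hn1 hn2 (Or.inr ⟨by rw [frameLast_neg, h]; rfl, by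
        rw [sum_frameCoord_neg]; linarith⟩))
  · exact Or.inl (key _ h1 h2 (Or.inl h))

theorem frame_of_mem_zeroOneDual {w : Fin (m + 1) → ℤ} (hw0 : w ≠ 0)
    (hw : w ∈ zeroOneDual (repartitioningComplex (m + 1))) :
    frameLast w ^ 2 + ∑ i, frameCoord w i ^ 2 = 2 ∧
      3 * frameLast w ^ 2 + (∑ i, frameCoord w i) ^ 2 = 4 := by
  rcases mem_zeroOneDual_iff.1 hw with h | ⟨k, rfl⟩
  · exact absurd h hw0
  rcases k with i | z
  · have h : dualGenerator (.inl i) = ofFrame (Pi.single i (1 : ℤ)) 0 := by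
      simp [dualGenerator, ofFrame]
    rw [h, frameLast_ofFrame, frameCoord_ofFrame]
    simp [Pi.single_apply]
  · induction z with | _ i j =>
    have hc : ∀ k, frameCoord (dualGenerator (.inr s(i, j))) k =
        (if k ∈ s(i, j) then (0 : ℤ) else 1) - 1 := by
      intro k; simp [frameCoord, dualGenerator]
    have hc2 : ∀ k, frameCoord (dualGenerator (.inr s(i, j))) k ^ 2 =
        1 - (if k ∈ s(i, j) then (0 : ℤ) else 1) := by
      intro k; rw [hc]; split_ifs <;> norm_num
    have hl : dualGenerator (.inr s(i, j)) (Fin.last m) = 1 := by simp [dualGenerator]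
    have hs : ∑ k, frameCoord (dualGenerator (.inr s(i, j))) k = -1 - if i = j then 0 else 1 := by
      simp only [hc, Finset.sum_sub_distrib, sum_ite_mem_sym2]
      simp
      ring
    have hp : ∑ k, frameCoord (dualGenerator (.inr s(i, j))) k ^ 2 =
        1 + if i = j then 0 else 1 := by
      simp only [hc2, Finset.sum_sub_distrib, sum_ite_mem_sym2]
      simp
      ring
    rw [frameLast, hl, hs, hp]
    split_ifs <;> norm_num

theorem dualGenerator_ne_zero (k : Fin m ⊕ Sym2 (Fin m)) : dualGenerator k ≠ 0 := by
  intro h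
  have := dualGenerator_dotProduct_dualTest_self k
  rw [h, zero_dotProduct] at this
  omega

theorem isArithmeticMinimum_formTF (hm : 4 ≤ m) : IsArithmeticMinimum (formTF (m + 1)) 1 := by
  have hK : (4 : ℝ) ≤ evenPart m := by exact_mod_cast four_le_evenPart hm
  constructor
  · have hne := dualGenerator_ne_zero (.inl (⟨0, by omega⟩ : Fin m))
    refine ⟨_, hne, (quadValue_formTF_eq_one_iff hm _).2 ?_⟩
    obtain ⟨h1, h2⟩ := frame_of_mem_zeroOneDual hne (dualGenerator_mem _)
    -- The numerator of TF_n is (K+2)(t² + p) - (3t² + s²), which is 2(K+2) - 4 = 2K here.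
    linear_combination (evenPart m + 2 : ℤ) * h1 - h2
  · rintro _ ⟨v, hv, rfl⟩
    have h := quadValue_formTF_toReal hm v
    have h2 := (Int.cast_le (R := ℝ)).2 (formTF_frame_estimate hm hv).1
    rw [← h] at h2
    push_cast at h2
    by_contra hc
    push Not at hc
    nlinarith

end MinimalVectors

/-! ### Listing and counting the minimal vectors of TF_n. -/

section Counting

/-- The number of vectors `± r k` for a family without repetitions up to sign. -/
theorem ncard_range_union_neg {α ι : Type*} [InvolutiveNeg α] [Fintype ι] {r : ι → α}
    (hr : Function.Injective r) (hn : ∀ k l, r k ≠ -r l) :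
    {v | ∃ k, v = r k ∨ v = -r k}.ncard = 2 * Fintype.card ι := by
  have h : {v | ∃ k, v = r k ∨ v = -r k} =
      Set.range fun p : Bool × ι => if p.1 then r p.2 else -r p.2 := by
    ext v
    constructor
    · rintro ⟨k, rfl | rfl⟩
      · exact ⟨(true, k), rfl⟩
      · exact ⟨(false, k), rfl⟩
    · rintro ⟨⟨b, k⟩, rfl⟩
      cases b
      · exact ⟨k, Or.inr rfl⟩
      · exact ⟨k, Or.inl rfl⟩
  have hinj : Function.Injective fun p : Bool × ι => if p.1 then r p.2 else -r p.2 := by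
    rintro ⟨a, k⟩ ⟨b, l⟩ h
    cases a <;> cases b <;> simp only [Bool.false_eq_true, if_false, if_true] at h
    · rw [hr (neg_injective h)]
    · exact absurd h.symm (hn l k)
    · exact absurd h (hn k l)
    · rw [hr h]
  rw [h, ← Nat.card_coe_set_eq, Nat.card_range_of_injective hinj, Nat.card_eq_fintype_card,
    Fintype.card_prod, Fintype.card_bool]

variable {m : ℕ}

theorem dualGenerator_injective : Function.Injective (dualGenerator (m := m)) := by
  intro k l h
  by_contra hne
  have h1 := dualGenerator_dotProduct_dualTest_self l
  have h2 := dualGenerator_dotProduct_dualTest_of_ne hne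
  rw [h] at h2
  omega

theorem dualGenerator_last_mem (k : Fin m ⊕ Sym2 (Fin m)) :
    dualGenerator k (Fin.last m) = 0 ∨ dualGenerator k (Fin.last m) = 1 := by
  rcases k with i | z <;> simp [dualGenerator]

theorem dualGenerator_ne_neg (k l : Fin m ⊕ Sym2 (Fin m)) :
    dualGenerator k ≠ -dualGenerator l := by
  intro h
  have hk := (mem_zeroOneDual.1 (dualGenerator_mem k))
  have hl := (mem_zeroOneDual.1 (dualGenerator_mem l))
  refine dualGenerator_ne_zero k (funext fun i => ?_)
  have hi := congrFun h i
  simp only [Pi.neg_apply] at hi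
  revert hi
  refine Fin.lastCases ?_ (fun i => ?_) i
  · intro hi
    have h1 := hk.2.1
    have h2 := hl.2.1
    simp only [Pi.zero_apply]; omega
  · intro hi
    have h1 := hk.1 i
    have h2 := hl.1 i
    simp only [Pi.zero_apply]; omega

/-- The minimal vectors of `TFₙ` are the vectors of the dual of the repartitioning complex and,
up to sign, vectors with frame coordinates in `{0, -1}` of the largest possible sum. -/
theorem mem_minimalVectors_formTF_iff (hm : 4 ≤ m) {v : Fin (m + 1) → ℤ} :
    v ∈ minimalVectors (formTF (m + 1)) ↔
      (∃ k, v = dualGenerator k ∨ v = -dualGenerator k) ∨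
      ∃ w, (v = w ∨ v = -w) ∧ (∀ i, frameCoord w i = 0 ∨ frameCoord w i = -1) ∧
        ((frameLast w = 0 ∧ ∑ i, frameCoord w i = -evenPart m) ∨
          ((frameLast w = 1 ∨ frameLast w = -1) ∧ ∑ i, frameCoord w i = -(evenPart m + 1))) := by
  have hK : (4 : ℤ) ≤ evenPart m := by exact_mod_cast four_le_evenPart hm
  rw [quadValue_of_mem_minimalVectors (isArithmeticMinimum_formTF hm),
    quadValue_formTF_eq_one_iff hm]
  constructor
  · rintro ⟨hv, h⟩
    obtain ⟨hp, hc⟩ := (formTF_frame_estimate hm hv).2 h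
    have hsmall : frameLast v ^ 2 + ∑ i, frameCoord v i ^ 2 = 2 →
        3 * frameLast v ^ 2 + (∑ i, frameCoord v i) ^ 2 = 4 →
        ∃ k, v = dualGenerator k ∨ v = -dualGenerator k := by
      intro h1 h2
      rcases neg_mem_zeroOneDual_or_mem h1 h2 with h | h
      · rcases mem_zeroOneDual_iff.1 h with h | ⟨k, hk⟩
        · exact absurd h hv
        · exact ⟨k, Or.inl hk⟩
      · rcases mem_zeroOneDual_iff.1 h with h | ⟨k, hk⟩
        · exact absurd (neg_eq_zero.1 h) hv
        · exact ⟨k, Or.inr (by rw [← hk, neg_neg])⟩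
    have hlarge : ((|frameLast v| = 0 ∧ |∑ i, frameCoord v i| = evenPart m) ∨
        (|frameLast v| = 1 ∧ |∑ i, frameCoord v i| = evenPart m + 1)) →
        ∃ w, (v = w ∨ v = -w) ∧ (∀ i, frameCoord w i = 0 ∨ frameCoord w i = -1) ∧
        ((frameLast w = 0 ∧ ∑ i, frameCoord w i = -evenPart m) ∨
          ((frameLast w = 1 ∨ frameLast w = -1) ∧
            ∑ i, frameCoord w i = -(evenPart m + 1))) := by
      intro h
      rcases le_or_gt (∑ i, frameCoord v i) 0 with hs | hs
      · rw [abs_of_nonpos hs] at hp h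
        refine ⟨v, Or.inl rfl, forall_eq_zero_or_neg_one hp, ?_⟩
        rcases h with ⟨h1, h2⟩ | ⟨h1, h2⟩
        · exact Or.inl ⟨abs_eq_zero.1 h1, by linarith⟩
        · exact Or.inr ⟨(abs_eq one_pos.le).1 h1, by linarith⟩
      · rw [abs_of_pos hs] at hp h
        refine ⟨-v, Or.inr (neg_neg v).symm, forall_eq_zero_or_neg_one ?_, ?_⟩
        · rw [sum_frameCoord_neg, neg_neg, ← hp]
          simp [frameCoord_neg]
        · rw [frameLast_neg, sum_frameCoord_neg]
          rcases h with ⟨h1, h2⟩ | ⟨h1, h2⟩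
          · exact Or.inl ⟨by rw [abs_eq_zero.1 h1, neg_zero], by linarith⟩
          · refine Or.inr ⟨?_, by linarith⟩
            rcases (abs_eq one_pos.le).1 h1 with h | h <;> rw [h] <;> norm_num
    rw [← sq_abs (frameLast v), ← sq_abs (∑ i, frameCoord v i), hp] at hsmall
    -- The small values of |s| give roots of D_n lying in the dual up to sign; the large ones give
    -- the vectors that are not shared with D_n.
    rcases hc with ⟨h1, h2 | h2⟩ | ⟨h1, h2 | h2⟩
    · exact Or.inl (hsmall (by rw [h1, h2]; norm_num) (by rw [h1, h2]; norm_num))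
    · exact Or.inr (hlarge (Or.inl ⟨h1, h2⟩))
    · exact Or.inl (hsmall (by rw [h1, h2]; norm_num) (by rw [h1, h2]; norm_num))
    · exact Or.inr (hlarge (Or.inr ⟨h1, h2⟩))
  · have hneg : ∀ w : Fin (m + 1) → ℤ, (w ≠ 0 ∧ (evenPart m - 1) * frameLast w ^ 2 +
        (evenPart m + 2) * ∑ i, frameCoord w i ^ 2 - (∑ i, frameCoord w i) ^ 2 =
          2 * (evenPart m : ℤ)) → ∀ v, v = w ∨ v = -w → (v ≠ 0 ∧
        (evenPart m - 1) * frameLast v ^ 2 + (evenPart m + 2) * ∑ i, frameCoord v i ^ 2 -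
          (∑ i, frameCoord v i) ^ 2 = 2 * (evenPart m : ℤ)) := by
      rintro w ⟨hw, h⟩ v (rfl | rfl)
      · exact ⟨hw, h⟩
      · refine ⟨neg_ne_zero.2 hw, ?_⟩
        rw [frameLast_neg, sum_frameCoord_neg, neg_sq, neg_sq, ← h]
        simp [frameCoord_neg]
    rintro (⟨k, hk⟩ | ⟨w, hvw, hx, hw⟩)
    · refine hneg _ ⟨dualGenerator_ne_zero k, ?_⟩ v hk
      obtain ⟨h1, h2⟩ := frame_of_mem_zeroOneDual (dualGenerator_ne_zero k) (dualGenerator_mem k)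
      linear_combination (evenPart m + 2 : ℤ) * h1 - h2
    · have hp : ∑ i, frameCoord w i ^ 2 = -∑ i, frameCoord w i := by
        rw [← Finset.sum_neg_distrib]
        exact Finset.sum_congr rfl fun i _ => by rcases hx i with h | h <;> rw [h] <;> norm_num
      refine hneg w ⟨?_, ?_⟩ v hvw
      · rintro rfl
        have : ∑ i, frameCoord (0 : Fin (m + 1) → ℤ) i = 0 := by simp [frameCoord]
        rw [this] at hw
        omega
      · rw [hp]
        rcases hw with ⟨h1, h2⟩ | ⟨h1 | h1, h2⟩ <;> rw [h1, h2] <;> ring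

theorem eq_neg_one_of_sum {x : Fin m → ℤ} (hx : ∀ i, x i = 0 ∨ x i = -1)
    (hs : ∑ i, x i = -m) : x = fun _ => -1 := by
  have h : ∑ i, (x i + 1) = 0 := by simp [Finset.sum_add_distrib, hs]
  rw [Finset.sum_eq_zero_iff_of_nonneg fun i _ => by rcases hx i with h | h <;> rw [h] <;> simp]
    at h
  ext i
  linarith [h i (Finset.mem_univ i)]

theorem eq_single_sub_one_of_sum {x : Fin m → ℤ} (hx : ∀ i, x i = 0 ∨ x i = -1)
    (hs : ∑ i, x i = 1 - m) : ∃ j, x = fun i => (Pi.single j 1 : Fin m → ℤ) i - 1 := by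
  have h : ∑ i, (x i + 1) = 1 := by simp [Finset.sum_add_distrib, hs]
  obtain ⟨j, hj⟩ := exists_eq_single_of_sum_eq_one
    (fun i => by rcases hx i with h | h <;> rw [h] <;> simp) h
  exact ⟨j, funext fun i => by rw [← hj]; ring⟩

theorem two_mul_card_sym2 (m : ℕ) : 2 * (m + 1).choose 2 = (m + 1) * m := by
  rw [Nat.choose_two_right, Nat.add_sub_cancel]
  exact Nat.mul_div_cancel' (by rw [mul_comm]; exact (Nat.even_mul_succ_self m).two_dvd)

theorem two_le_half (hm : 4 ≤ m) : (2 : ℤ) ≤ ((m / 2 : ℕ) : ℤ) := by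
  have : 2 ≤ m / 2 := by omega
  exact_mod_cast this

theorem evenPart_cast (m : ℕ) : (evenPart m : ℤ) = 2 * ((m / 2 : ℕ) : ℤ) := by
  unfold evenPart; push_cast; rfl

/-- Adding to the dual generators vectors with last coordinate at least two keeps them distinct up
to sign. -/
theorem ncard_elim_dualGenerator {κ : Type*} [Fintype κ] {e : κ → Fin (m + 1) → ℤ}
    (he : Function.Injective e) (hl : ∀ k, 2 ≤ e k (Fin.last m)) :
    {v | (∃ k, v = dualGenerator k ∨ v = -dualGenerator k) ∨ ∃ k, v = e k ∨ v = -e k}.ncard =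
      m * (m + 3) + 2 * Fintype.card κ := by
  have hset : {v | (∃ k, v = dualGenerator k ∨ v = -dualGenerator k) ∨
      ∃ k, v = e k ∨ v = -e k} =
      {v | ∃ k, v = Sum.elim dualGenerator e k ∨ v = -Sum.elim dualGenerator e k} := by
    ext v; simp [-Sum.exists, Sum.exists (p := fun k => v = Sum.elim dualGenerator e k ∨
      v = -Sum.elim dualGenerator e k)]
  rw [hset, ncard_range_union_neg, Fintype.card_sum, Fintype.card_sum, Sym2.card,
    Fintype.card_fin, mul_add, mul_add, two_mul_card_sym2]
  · ring
  · rintro (k | k) (l | l) h <;> simp only [Sum.elim_inl, Sum.elim_inr] at h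
    · rw [dualGenerator_injective h]
    · have := dualGenerator_last_mem k
      have := hl l
      have := congrFun h (Fin.last m)
      omega
    · have := dualGenerator_last_mem l
      have := hl k
      have := congrFun h (Fin.last m)
      omega
    · rw [he h]
  · rintro (k | k) (l | l) h <;> simp only [Sum.elim_inl, Sum.elim_inr] at h
    · exact dualGenerator_ne_neg k l h
    · have := dualGenerator_last_mem k
      have := hl l
      have := congrFun h (Fin.last m)
      simp only [Pi.neg_apply] at this
      omega
    · have := dualGenerator_last_mem l
      have := hl k
      have := congrFun h (Fin.last m)
      simp only [Pi.neg_apply] at this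
      omega
    · have := hl k
      have := hl l
      have := congrFun h (Fin.last m)
      simp only [Pi.neg_apply] at this
      omega

theorem ncard_minimalVectors_formTF_of_even (hm : 4 ≤ m) (h : Even m) :
    (minimalVectors (formTF (m + 1))).ncard = (m + 1) * (m + 1 + 1) := by
  have hK := evenPart_of_even h
  have hK2 := evenPart_cast m
  rw [hK] at hK2
  have h2 := two_le_half hm
  have hset : minimalVectors (formTF (m + 1)) =
      {v | (∃ k, v = dualGenerator k ∨ v = -dualGenerator k) ∨
        ∃ k : Unit, v = ofFrame (fun _ : Fin m => (-1 : ℤ)) ((m / 2 : ℕ) : ℤ) ∨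
          v = -ofFrame (fun _ : Fin m => (-1 : ℤ)) ((m / 2 : ℕ) : ℤ)} := by
    ext v
    rw [mem_minimalVectors_formTF_iff hm, Set.mem_ofPred_eq, hK]
    refine or_congr_right ⟨?_, ?_⟩
    · rintro ⟨w, hvw, hx, hw⟩
      -- For even m, K = m: sum -m forces every x_i = -1, and t = 0 then fixes the last coordinate
      -- m/2. The sum -(m+1) is out of reach for m coordinates in {0,-1}.
      have hw' : w = ofFrame (fun _ : Fin m => (-1 : ℤ)) ((m / 2 : ℕ) : ℤ) := by
        rcases hw with ⟨h1, h3⟩ | ⟨-, h3⟩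
        · rw [← ofFrame_frameCoord w, eq_neg_one_of_sum hx h3]
          rw [frameLast, h3] at h1
          congr 1
          linarith
        · have : ∑ i : Fin m, (-1 : ℤ) ≤ ∑ i, frameCoord w i := Finset.sum_le_sum fun i _ => by
            rcases hx i with h | h <;> simp [h]
          simp at this
          omega
      exact ⟨(), hw' ▸ hvw⟩
    · rintro ⟨-, hv⟩
      refine ⟨_, hv, fun i => Or.inr (by rw [frameCoord_ofFrame]), Or.inl ⟨?_, ?_⟩⟩
      · rw [frameLast_ofFrame]; simp; omega
      · rw [frameCoord_ofFrame]; simp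
  rw [hset, ncard_elim_dualGenerator (κ := Unit) (fun _ _ _ => rfl)
    (fun _ => by rw [ofFrame_last]; exact h2), Fintype.card_unit]
  ring

/-- The minimal vectors of `TFₙ` for even `n` which are not minimal for the form of type `D`. -/
def evenExtraVector (m : ℕ) : Fin m ⊕ Bool → Fin (m + 1) → ℤ
  | .inl j => ofFrame (fun i => (Pi.single j 1 : Fin m → ℤ) i - 1) ((m / 2 : ℕ) : ℤ)
  | .inr b => ofFrame (fun _ => -1) (((m / 2 : ℕ) : ℤ) + if b then 1 else 0)

theorem evenExtraVector_injective : Function.Injective (evenExtraVector m) := by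
  have hof : ∀ {x y : Fin m → ℤ} {a b : ℤ}, ofFrame x a = ofFrame y b → x = y ∧ a = b := by
    intro x y a b h
    exact ⟨by rw [← frameCoord_ofFrame x a, h, frameCoord_ofFrame],
      by rw [← ofFrame_last x a, h, ofFrame_last]⟩
  rintro (j | b) (k | c) h <;> simp only [evenExtraVector] at h <;> obtain ⟨h1, h2⟩ := hof h
  · have := congrFun h1 j
    by_cases hjk : j = k
    · rw [hjk]
    · simp [Pi.single_eq_of_ne hjk] at this
  · simpa using congrFun h1 j
  · simpa using congrFun h1 k
  · cases b <;> cases c <;> simp at h2 ⊢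

theorem ncard_minimalVectors_formTF_of_odd (hm : 4 ≤ m) (h : Odd m) :
    (minimalVectors (formTF (m + 1))).ncard = (m + 1) * (m + 1 + 3) := by
  have hK : (evenPart m : ℤ) = m - 1 := by
    rw [eq_sub_iff_add_eq]; exact_mod_cast evenPart_of_odd h
  have hK2 := evenPart_cast m
  have h2 := two_le_half hm
  have hset : minimalVectors (formTF (m + 1)) =
      {v | (∃ k, v = dualGenerator k ∨ v = -dualGenerator k) ∨
        ∃ k, v = evenExtraVector m k ∨ v = -evenExtraVector m k} := by
    ext v
    rw [mem_minimalVectors_formTF_iff hm, Set.mem_ofPred_eq]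
    refine or_congr_right ⟨?_, ?_⟩
    · rintro ⟨w, hvw, hx, hw⟩
      suffices h : ∃ k, w = evenExtraVector m k by
        obtain ⟨k, rfl⟩ := h
        exact ⟨k, hvw⟩
      -- For odd m, K = m-1: sum 1-m leaves one zero coordinate (m choices, t = 0), and sum -m
      -- leaves none (two choices, t = 1 or t = -1).
      rcases hw with ⟨h1, h3⟩ | ⟨h1, h3⟩
      · obtain ⟨j, hj⟩ := eq_single_sub_one_of_sum hx (by rw [h3, hK]; ring)
        refine ⟨.inl j, ?_⟩
        rw [← ofFrame_frameCoord w, hj, evenExtraVector]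
        rw [frameLast, h3] at h1
        congr 1
        linarith
      · have hj := eq_neg_one_of_sum hx (by rw [h3, hK]; ring)
        rw [frameLast, h3] at h1
        rcases h1 with h1 | h1
        · refine ⟨.inr true, ?_⟩
          rw [← ofFrame_frameCoord w, hj, evenExtraVector, if_pos rfl]
          congr 1
          linarith
        · refine ⟨.inr false, ?_⟩
          rw [← ofFrame_frameCoord w, hj, evenExtraVector, if_neg (by simp)]
          congr 1
          linarith
    · rintro ⟨k, hv⟩
      refine ⟨_, hv, ?_, ?_⟩
      · intro i
        rcases k with j | b
        · rw [evenExtraVector, frameCoord_ofFrame]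
          by_cases hij : i = j
          · subst hij; simp
          · simp [Pi.single_eq_of_ne hij]
        · rw [evenExtraVector, frameCoord_ofFrame]; simp
      · rcases k with j | b
        · left
          rw [evenExtraVector, frameCoord_ofFrame, frameLast_ofFrame]
          simp
          constructor <;> omega
        · right
          rw [evenExtraVector, frameCoord_ofFrame, frameLast_ofFrame]
          cases b
          · simp; omega
          · simp; omega
  rw [hset, ncard_elim_dualGenerator evenExtraVector_injective ?_, Fintype.card_sum,
    Fintype.card_fin, Fintype.card_bool]
  · ring
  · rintro (j | b)
    · rw [evenExtraVector, ofFrame_last]; exact h2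
    · rw [evenExtraVector, ofFrame_last]; split_ifs <;> linarith

end Counting

/-! ### The cases n = 5 and n = 6 by explicit unimodular matrices. -/

section Equivalence

theorem integrallyEquivalent_smul_map {n : ℕ} {c : ℝ} {F G U : Matrix (Fin n) (Fin n) ℤ}
    (hU : IsUnit U.det) (h : F = Uᵀ * G * U) :
    IntegrallyEquivalent (c • F.map (Int.cast : ℤ → ℝ)) (c • G.map (Int.cast : ℤ → ℝ)) := by
  refine ⟨U, hU, ?_⟩
  have hmap : ∀ A B : Matrix (Fin n) (Fin n) ℤ,
      (A * B).map (Int.cast : ℤ → ℝ) = A.map Int.cast * B.map Int.cast :=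
    fun A B => Matrix.map_mul (f := Int.castRingHom ℝ)
  rw [h, hmap, hmap, ← Matrix.transpose_map, Matrix.mul_smul, Matrix.smul_mul]

/-- Both forms are 1/12 times integral ones. An explicit base change is checked by evaluation, its
unimodularity being certified by an integral inverse. -/
theorem formTF_five_equivalent : IntegrallyEquivalent (formTF 5) formPhi25 := by
  have h : formTF 5 = (1 / 12 : ℝ) • (!![12, 3, 3, 3, -12; 3, 12, 3, 3, -12; 3, 3, 12, 3, -12;
      3, 3, 3, 12, -12; -12, -12, -12, -12, 30] : Matrix (Fin 5) (Fin 5) ℤ).map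
        (Int.cast : ℤ → ℝ) := by
    ext i j
    fin_cases i <;> fin_cases j <;> simp [formTF, show ¬ Even 5 by decide] <;> norm_num
  rw [h]
  refine integrallyEquivalent_smul_map (U := !![-2, 1, 1, 1, -1; 0, -1, -1, -1, 2;
    1, -2, -1, -1, 2; 2, -2, -2, -1, 2; 1, -1, -1, -1, 1]) ?_ (by decide)
  exact (Matrix.isUnit_iff_isUnit_det _).1 (IsUnit.of_mul_eq_one !![-1, 0, 0, 0, -1;
    -1, 1, -1, 0, -1; -1, 0, 1, -1, -1; 0, 0, 0, 1, -2; -1, 1, 0, 0, -2] (by decide))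

/-- Three times the inverse of the Cartan matrix is integral; the scale is 3/4 · 1/3. -/
theorem formE6Star_eq : formE6Star = (1 / 4 : ℝ) • (!![4, 3, 5, 6, 4, 2; 3, 6, 6, 9, 6, 3;
    5, 6, 10, 12, 8, 4; 6, 9, 12, 18, 12, 6; 4, 6, 8, 12, 10, 5; 2, 3, 4, 6, 5, 4] :
      Matrix (Fin 6) (Fin 6) ℤ).map (Int.cast : ℤ → ℝ) := by
  set N : Matrix (Fin 6) (Fin 6) ℤ := !![4, 3, 5, 6, 4, 2; 3, 6, 6, 9, 6, 3;
    5, 6, 10, 12, 8, 4; 6, 9, 12, 18, 12, 6; 4, 6, 8, 12, 10, 5; 2, 3, 4, 6, 5, 4] with hN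
  have h : CartanMatrix.E₆ * N = (3 : ℤ) • 1 := by decide
  have h2 : CartanMatrix.E₆.map (Int.cast : ℤ → ℝ) * ((1 / 3 : ℝ) • N.map (Int.cast : ℤ → ℝ)) =
      1 := by
    have hmap : (CartanMatrix.E₆ * N).map (Int.cast : ℤ → ℝ) =
        CartanMatrix.E₆.map Int.cast * N.map Int.cast :=
      Matrix.map_mul (f := Int.castRingHom ℝ)
    rw [Matrix.mul_smul, ← hmap, h]
    ext i j
    by_cases hij : i = j
    · subst hij; simp [Matrix.ofNat_apply]
    · simp [Matrix.ofNat_apply, hij]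
  rw [formE6Star, Matrix.inv_eq_right_inv h2, smul_smul]
  norm_num

theorem formTF_six_equivalent : IntegrallyEquivalent (formTF 6) formE6Star := by
  have h : formTF 6 = (1 / 4 : ℝ) • (!![4, 1, 1, 1, 1, -5; 1, 4, 1, 1, 1, -5; 1, 1, 4, 1, 1, -5;
      1, 1, 1, 4, 1, -5; 1, 1, 1, 1, 4, -5; -5, -5, -5, -5, -5, 16] :
        Matrix (Fin 6) (Fin 6) ℤ).map (Int.cast : ℤ → ℝ) := by
    ext i j
    fin_cases i <;> fin_cases j <;> simp [formTF, show Even 6 by decide] <;> norm_num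
  rw [h, formE6Star_eq]
  refine integrallyEquivalent_smul_map (U := !![-1, -1, -1, -1, -1, 3; -1, 0, 0, 0, 0, 1;
    0, 0, 1, 1, 1, -2; 1, 0, -1, 0, 0, 0; 0, 0, 1, -1, 0, 0; 0, 0, 0, 1, -1, 0]) ?_ (by decide)
  exact (Matrix.isUnit_iff_isUnit_det _).1 (IsUnit.of_mul_eq_one !![0, 2, 1, 3, 2, 1;
    -1, 1, -1, 0, 0, 0; 0, 2, 1, 2, 2, 1; 0, 2, 1, 2, 1, 1; 0, 2, 1, 2, 1, 0;
    0, 3, 1, 3, 2, 1] (by decide))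

end Equivalence

/-! ### The form of type D in standard coordinates and its equivalence with half the Cartan matrix.
-/

section RootLatticeD

variable {m : ℕ}

/-- The simple roots of the root lattice `D` of rank `m + 1`. -/
def simpleRootD (m : ℕ) (j : Fin (m + 1)) : Fin (m + 1) → ℤ :=
  -- The truncated indices let one formula give e_j - e_{j+1} for j < m and e_{m-1} + e_m for j = m,
  -- with indices starting at 0.
  Pi.single ⟨min (j : ℕ) (m - 1), by omega⟩ 1 +
    (if (j : ℕ) = m then (1 : ℤ) else -1) • Pi.single ⟨min ((j : ℕ) + 1) m, by omega⟩ 1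

theorem simpleRootD_apply (j k : Fin (m + 1)) : simpleRootD m j k =
    (if (k : ℕ) = min (j : ℕ) (m - 1) then 1 else 0) +
      (if (j : ℕ) = m then 1 else -1) * if (k : ℕ) = min ((j : ℕ) + 1) m then 1 else 0 := by
  simp only [simpleRootD, Pi.add_apply, Pi.smul_apply, Pi.single_apply, Fin.ext_iff, smul_eq_mul]

theorem sum_simpleRootD (j : Fin (m + 1)) :
    ∑ k, simpleRootD m j k = 1 + if (j : ℕ) = m then (1 : ℤ) else -1 := by
  simp only [simpleRootD, Pi.add_apply, Pi.smul_apply, Finset.sum_add_distrib, ← Finset.smul_sum]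
  simp

/-- The simple roots of the root lattice `D`, as rows of a matrix. -/
def simpleRootsD (m : ℕ) : Matrix (Fin (m + 1)) (Fin (m + 1)) ℤ :=
  Matrix.of (simpleRootD m)

theorem simpleRootsD_mul_transpose (hm : 4 ≤ m) :
    simpleRootsD m * (simpleRootsD m)ᵀ = CartanMatrix.D (m + 1) := by
  ext i j
  have h : (simpleRootsD m * (simpleRootsD m)ᵀ) i j = simpleRootD m i ⬝ᵥ simpleRootD m j := rfl
  rw [h, simpleRootD, add_dotProduct, smul_dotProduct, single_one_dotProduct,
    single_one_dotProduct, simpleRootD_apply, simpleRootD_apply]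
  simp only [CartanMatrix.D, Matrix.of_apply, Fin.ext_iff, smul_eq_mul,
    if_neg (show ¬ m + 1 ≤ 2 by omega)]
  have hi := i.2
  have hj := j.2
  have hcase : ∀ a : ℕ, a < m + 1 → (a = m ∧ min a (m - 1) = m - 1 ∧ min (a + 1) m = m) ∨
      (a ≠ m ∧ min a (m - 1) = a ∧ min (a + 1) m = a + 1) := by omega
  rcases hcase i hi with ⟨h1, h2, h3⟩ | ⟨h1, h2, h3⟩ <;>
    rcases hcase j hj with ⟨h4, h5, h6⟩ | ⟨h4, h5, h6⟩ <;>
    simp only [h2, h3, h5, h6] <;> simp only [h1, h4, if_true, if_false, or_true, and_true] <;>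
    split_ifs <;> omega

/-- The matrix of the change to the frame coordinates. -/
def frameMatrix (m : ℕ) : Matrix (Fin (m + 1)) (Fin (m + 1)) ℤ :=
  Matrix.of fun i j => (Fin.snoc (α := fun _ => ℤ) (frameCoord (Pi.single j (1 : ℤ)))
    (frameLast (Pi.single j (1 : ℤ))) : Fin (m + 1) → ℤ) i

theorem frameMatrix_castSucc {R : Type*} [CommRing R] (v : Fin (m + 1) → R) (i : Fin m) :
    ((frameMatrix m).map (Int.cast : ℤ → R) *ᵥ v) i.castSucc = frameCoord v i := by
  simp [Matrix.mulVec, dotProduct, frameMatrix, frameCoord, Pi.single_apply, sub_mul]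

theorem frameLast_eq {R : Type*} [CommRing R] (v : Fin (m + 1) → R) :
    frameLast v = ∑ i : Fin m, v i.castSucc + (2 - m) * v (Fin.last m) := by
  rw [frameLast, sum_frameCoord]; ring

theorem frameMatrix_last {R : Type*} [CommRing R] (v : Fin (m + 1) → R) :
    ((frameMatrix m).map (Int.cast : ℤ → R) *ᵥ v) (Fin.last m) = frameLast v := by
  rw [frameLast_eq]
  have h1 : ∀ j : Fin m, frameLast (Pi.single j.castSucc 1 : Fin (m + 1) → ℤ) = 1 := fun j => by
    rw [frameLast_eq, Pi.single_eq_of_ne (Fin.castSucc_lt_last j).ne']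
    simp [Pi.single_apply]
  have h2 : frameLast (Pi.single (Fin.last m) 1 : Fin (m + 1) → ℤ) = 2 - m := by
    rw [frameLast_eq]
    simp
  simp [Matrix.mulVec, dotProduct, frameMatrix, h1, h2, Fin.sum_univ_castSucc (n := m)]

/-- The simple roots in the standard coordinates. -/
def simpleRootsFrame (m : ℕ) : Matrix (Fin (m + 1)) (Fin (m + 1)) ℤ :=
  -- The last standard coordinate is (t - s)/2; among the simple roots it is nonzero only for
  -- e_{m-1} - e_m, where it is -1.
  Matrix.of fun k j => ofFrame (fun i : Fin m => simpleRootD m j i.castSucc)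
    (if (j : ℕ) + 1 = m then -1 else 0) k

theorem frameMatrix_mul_simpleRootsFrame (hm : 4 ≤ m) :
    frameMatrix m * simpleRootsFrame m = (simpleRootsD m)ᵀ := by
  ext k j
  have h : (frameMatrix m * simpleRootsFrame m) k j =
      ((frameMatrix m).map (Int.cast : ℤ → ℤ) *ᵥ
        ofFrame (fun i : Fin m => simpleRootD m j i.castSucc)
          (if (j : ℕ) + 1 = m then -1 else 0)) k := rfl
  rw [h, Matrix.transpose_apply, show simpleRootsD m j k = simpleRootD m j k from rfl]
  refine Fin.lastCases ?_ (fun k => ?_) k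
  · rw [frameMatrix_last, frameLast_ofFrame]
    have hsum : ∑ i : Fin m, simpleRootD m j i.castSucc =
        ∑ i, simpleRootD m j i - simpleRootD m j (Fin.last m) := by
      rw [Fin.sum_univ_castSucc, add_sub_cancel_right]
    rw [hsum, sum_simpleRootD, simpleRootD_apply, Fin.val_last]
    have hj := j.2
    split_ifs <;> omega
  · rw [frameMatrix_castSucc, frameCoord_ofFrame]

/-- The columns generate the whole integral lattice: the last one is a basis vector, and adding the
others one at a time telescopes down to all of the first m basis vectors. -/
theorem isUnit_det_simpleRootsFrame (hm : 4 ≤ m) : IsUnit (simpleRootsFrame m).det := by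
  have hcol : ∀ j, simpleRootsFrame m *ᵥ Pi.single j 1 =
      ofFrame (fun i : Fin m => simpleRootD m j i.castSucc)
        (if (j : ℕ) + 1 = m then -1 else 0) := by
    intro j
    rw [Matrix.mulVec_single_one]
    rfl
  have hsingle : ∀ i : Fin m, ofFrame (Pi.single i (1 : ℤ)) 0 =
      (Pi.single i.castSucc 1 : Fin (m + 1) → ℤ) := by
    intro i
    ext k
    refine Fin.lastCases ?_ (fun k => ?_) k
    · simp [ofFrame]
    · simp [ofFrame, Pi.single_apply]
  set L := LinearMap.range (simpleRootsFrame m).mulVecLin with hL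
  have hmem : ∀ j, ofFrame (fun i : Fin m => simpleRootD m j i.castSucc)
        (if (j : ℕ) + 1 = m then -1 else 0) ∈ L := fun j => ⟨Pi.single j 1, hcol j⟩
  have hstep : ∀ d, ∀ i : Fin m, (i : ℕ) + d + 1 = m → Pi.single i.castSucc 1 ∈ L := by
    intro d
    induction d with
    | zero =>
      intro i hi
      convert hmem (Fin.last m) using 1
      rw [← hsingle, Fin.val_last, if_neg (by omega)]
      congr 1
      ext k
      have := k.2
      simp only [simpleRootD_apply, Pi.single_apply, Fin.ext_iff, Fin.val_last, Fin.val_castSucc]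
      split_ifs <;> omega
    | succ d ih =>
      intro i hi
      have h1 := ih ⟨i + 1, by omega⟩ (by simp; omega)
      convert L.add_mem (hmem i.castSucc) h1 using 1
      rw [← hsingle, ← hsingle, Fin.val_castSucc, if_neg (by omega)]
      ext k
      refine Fin.lastCases ?_ (fun k => ?_) k
      · simp [ofFrame]
      · have := k.2
        simp only [ofFrame, Fin.snoc_castSucc, simpleRootD_apply, Pi.add_apply, Pi.single_apply,
          Fin.ext_iff, Fin.val_castSucc]
        split_ifs <;> omega
  have hbasis : ∀ i : Fin m, Pi.single i.castSucc 1 ∈ L := fun i =>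
    hstep (m - 1 - i) i (by omega)
  -- The roots e_{m-1} + e_m and e_{m-1} - e_m differ only in t; their difference is the all-ones
  -- vector in standard coordinates, from which the last basis vector follows.
  have hones : ofFrame (0 : Fin m → ℤ) 1 ∈ L := by
    convert L.sub_mem (hbasis ⟨m - 1, by omega⟩) (hmem ⟨m - 1, by omega⟩) using 1
    rw [← hsingle, if_pos (by simp; omega)]
    ext k
    refine Fin.lastCases ?_ (fun k => ?_) k
    · simp [ofFrame]
    · have := k.2
      simp only [ofFrame, Fin.snoc_castSucc, simpleRootD_apply, Pi.sub_apply, Pi.single_apply,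
        Fin.ext_iff, Fin.val_castSucc, Pi.zero_apply]
      split_ifs <;> omega
  have hlast : (Pi.single (Fin.last m) 1 : Fin (m + 1) → ℤ) ∈ L := by
    convert L.sub_mem hones (L.sum_mem fun i (_ : i ∈ Finset.univ) => hbasis i) using 1
    ext k
    refine Fin.lastCases ?_ (fun k => ?_) k
    · simp [ofFrame]
    · simp [ofFrame, Pi.single_apply]
  have htop : L = ⊤ := by
    rw [eq_top_iff, ← (Pi.basisFun ℤ (Fin (m + 1))).span_eq, Submodule.span_le]
    rintro _ ⟨i, rfl⟩
    rw [Pi.basisFun_apply]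
    exact Fin.lastCases hlast hbasis i
  rw [← Matrix.isUnit_iff_isUnit_det, ← Matrix.mulVec_surjective_iff_isUnit]
  exact LinearMap.range_eq_top.1 htop

/-- The form of the root lattice `D` in the standard coordinates. -/
noncomputable def frameForm (m : ℕ) : Matrix (Fin (m + 1)) (Fin (m + 1)) ℝ :=
  (1 / 2 : ℝ) • ((frameMatrix m)ᵀ * frameMatrix m).map (Int.cast : ℤ → ℝ)

theorem frameForm_equivalent (hm : 4 ≤ m) :
    IntegrallyEquivalent (frameForm m) (formD (m + 1)) := by
  have hu := isUnit_det_simpleRootsFrame hm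
  have h : frameMatrix m = (simpleRootsD m)ᵀ * (simpleRootsFrame m)⁻¹ := by
    rw [← frameMatrix_mul_simpleRootsFrame hm, Matrix.mul_nonsing_inv_cancel_right _ _ hu]
  refine integrallyEquivalent_smul_map (U := (simpleRootsFrame m)⁻¹)
    (Matrix.isUnit_nonsing_inv_det _ hu) ?_
  rw [← simpleRootsD_mul_transpose hm, h, Matrix.transpose_mul, Matrix.transpose_transpose]
  simp only [Matrix.mul_assoc]

theorem quadValue_frameForm (z : Fin (m + 1) → ℝ) :
    quadValue (frameForm m) z = (frameLast z ^ 2 + ∑ i, frameCoord z i ^ 2) / 2 := by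
  have hmap : ((frameMatrix m)ᵀ * frameMatrix m).map (Int.cast : ℤ → ℝ) =
      ((frameMatrix m).map Int.cast)ᵀ * (frameMatrix m).map Int.cast :=
    Matrix.map_mul (f := Int.castRingHom ℝ)
  rw [quadValue, frameForm, hmap, Matrix.smul_mulVec, dotProduct_smul, ← Matrix.mulVec_mulVec,
    Matrix.dotProduct_mulVec, Matrix.vecMul_transpose, dotProduct_eq_castSucc_add_last]
  simp only [frameMatrix_castSucc, frameMatrix_last, smul_eq_mul, ← sq]
  ring

theorem frameForm_isSymm (m : ℕ) : (frameForm m).IsSymm := by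
  refine Matrix.IsSymm.smul ?_ _
  rw [Matrix.IsSymm, ← Matrix.transpose_map, Matrix.transpose_mul, Matrix.transpose_transpose]

theorem frameForm_posDef (m : ℕ) : (frameForm m).PosDef := by
  refine posDef_of_quadValue_pos (frameForm_isSymm m) fun z hz => ?_
  rw [quadValue_frameForm]
  have hp : 0 ≤ ∑ i, frameCoord z i ^ 2 := Finset.sum_nonneg fun i _ => sq_nonneg _
  by_contra hneg
  push Not at hneg
  have h2 := sq_nonneg (frameLast z)
  refine hz (eq_zero_of_frame (fun i => ?_) ?_)
  · simpa using (Finset.sum_eq_zero_iff_of_nonneg fun i _ => sq_nonneg _).1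
      (show ∑ i, frameCoord z i ^ 2 = 0 by linarith) i (Finset.mem_univ i)
  · exact pow_eq_zero_iff two_ne_zero |>.1 (by linarith)

theorem quadValue_frameForm_toReal (v : Fin (m + 1) → ℤ) :
    2 * quadValue (frameForm m) (toReal v) =
      ((frameLast v ^ 2 + ∑ i, frameCoord v i ^ 2 : ℤ) : ℝ) := by
  rw [quadValue_frameForm, frameLast_toReal, sum_frameCoord_sq_toReal]
  push_cast
  ring

theorem quadValue_frameForm_eq_one_iff (v : Fin (m + 1) → ℤ) :
    quadValue (frameForm m) (toReal v) = 1 ↔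
      frameLast v ^ 2 + ∑ i, frameCoord v i ^ 2 = 2 := by
  rw [← @Int.cast_inj ℝ, ← quadValue_frameForm_toReal]
  push_cast
  constructor <;> intro h <;> linarith

theorem isArithmeticMinimum_frameForm (hm : 4 ≤ m) : IsArithmeticMinimum (frameForm m) 1 := by
  constructor
  · have hne := dualGenerator_ne_zero (.inl (⟨0, by omega⟩ : Fin m))
    exact ⟨_, hne, (quadValue_frameForm_eq_one_iff _).2
      (frame_of_mem_zeroOneDual hne (dualGenerator_mem _)).1⟩
  · rintro _ ⟨v, hv, rfl⟩
    have hp : 0 ≤ ∑ i, frameCoord v i ^ 2 := Finset.sum_nonneg fun i _ => sq_nonneg _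
    have ht := sq_nonneg (frameLast v)
    -- Here t and s have the same parity, and so do s and p; hence norms in the frame are even and
    -- the nonzero ones are at least 2.
    have heven : Even (frameLast v ^ 2 + ∑ i, frameCoord v i ^ 2) := by
      have h1 := even_sum_sq_sub_sum (frameCoord v)
      have h2 := even_frameLast_sub v
      rw [Int.even_sub] at h1 h2
      rw [Int.even_add, h1, ← h2, Int.even_pow' two_ne_zero]
    have hpos : 0 < frameLast v ^ 2 + ∑ i, frameCoord v i ^ 2 := by
      rcases frame_ne_zero hv with h | h
      · have := pow_pos (abs_pos.2 h) 2
        rw [sq_abs] at this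
        omega
      · omega
    have h2 : (2 : ℤ) ≤ frameLast v ^ 2 + ∑ i, frameCoord v i ^ 2 := by
      obtain ⟨k, hk⟩ := heven
      omega
    have h3 := (Int.cast_le (R := ℝ)).2 h2
    rw [← quadValue_frameForm_toReal] at h3
    push_cast at h3
    linarith

end RootLatticeD

/-! ### TW(n) as the cone of common minimal vectors, and the final assembly. -/

section CommonWall

variable {m : ℕ}

theorem mem_common_minimalVectors_iff (hm : 4 ≤ m) {v : Fin (m + 1) → ℤ} :
    v ∈ minimalVectors (frameForm m) ∩ minimalVectors (formTF (m + 1)) ↔ v ≠ 0 ∧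
      frameLast v ^ 2 + ∑ i, frameCoord v i ^ 2 = 2 ∧
      3 * frameLast v ^ 2 + (∑ i, frameCoord v i) ^ 2 = 4 := by
  rw [Set.mem_inter_iff, quadValue_of_mem_minimalVectors (isArithmeticMinimum_formTF hm),
    quadValue_of_mem_minimalVectors (isArithmeticMinimum_frameForm hm),
    quadValue_formTF_eq_one_iff hm, quadValue_frameForm_eq_one_iff]
  constructor
  · rintro ⟨⟨hv, h1⟩, -, h2⟩
    exact ⟨hv, h1, by linear_combination (evenPart m + 2 : ℤ) * h1 - h2⟩
  · rintro ⟨hv, h1, h2⟩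
    exact ⟨⟨hv, h1⟩, hv, by linear_combination (evenPart m + 2 : ℤ) * h1 - h2⟩

theorem tameWall_eq_voronoiCone (hm : 4 ≤ m) : tameWall (m + 1) =
    voronoiCone (minimalVectors (frameForm m) ∩ minimalVectors (formTF (m + 1))) := by
  apply le_antisymm
  · refine voronoiCone_le fun v hv => ?_
    by_cases h0 : v = 0
    · exact Or.inl h0
    · exact Or.inr (Or.inl ((mem_common_minimalVectors_iff hm).2
        ⟨h0, frame_of_mem_zeroOneDual h0 hv⟩))
  · refine voronoiCone_le fun v hv => ?_
    obtain ⟨-, h1, h2⟩ := (mem_common_minimalVectors_iff hm).1 hv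
    exact Or.inr (neg_mem_zeroOneDual_or_mem h1 h2)

theorem exists_mem_minimalVectors_frameForm_notMem (hm : 4 ≤ m) :
    ∃ v ∈ minimalVectors (frameForm m), v ∉ minimalVectors (formTF (m + 1)) := by
  -- This root has s = t = 0, so 3t² + s² = 4 fails.
  set x : Fin m → ℤ := Pi.single ⟨0, by omega⟩ 1 - Pi.single ⟨1, by omega⟩ 1 with hx
  have hs : ∑ i, x i = 0 := by simp [hx]
  have hp : ∑ i, x i ^ 2 = 2 := by
    have : ∀ i, x i ^ 2 = (Pi.single ⟨0, by omega⟩ 1 : Fin m → ℤ) i +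
        (Pi.single ⟨1, by omega⟩ 1 : Fin m → ℤ) i := by
      intro i
      simp only [hx, Pi.sub_apply, Pi.single_apply, Fin.ext_iff]
      split_ifs <;> omega
    simp [this, Finset.sum_add_distrib]
  have ht : frameLast (ofFrame x 0) = 0 := by rw [frameLast_ofFrame, hs]; rfl
  have hmem : ofFrame x 0 ∈ minimalVectors (frameForm m) := by
    rw [quadValue_of_mem_minimalVectors (isArithmeticMinimum_frameForm hm),
      quadValue_frameForm_eq_one_iff, ht, frameCoord_ofFrame, hp]
    refine ⟨fun h => ?_, by norm_num⟩
    have h1 := frameCoord_ofFrame x 0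
    rw [h] at h1
    rw [← h1] at hp
    simp [frameCoord] at hp
  refine ⟨_, hmem, fun h => ?_⟩
  have := ((mem_common_minimalVectors_iff hm).1 ⟨hmem, h⟩).2.2
  rw [ht, frameCoord_ofFrame, hs] at this
  norm_num at this

theorem exists_mem_minimalVectors_formTF_notMem (hm : 4 ≤ m) :
    ∃ v ∈ minimalVectors (formTF (m + 1)), v ∉ minimalVectors (frameForm m) := by
  have hK := four_le_evenPart hm
  have hmem : ∀ w : Fin (m + 1) → ℤ, (∀ i, frameCoord w i = 0 ∨ frameCoord w i = -1) →
      frameLast w = 0 → ∑ i, frameCoord w i = -evenPart m →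
      w ∈ minimalVectors (formTF (m + 1)) ∧ w ∉ minimalVectors (frameForm m) := by
    intro w hx ht hs
    have h1 : w ∈ minimalVectors (formTF (m + 1)) :=
      (mem_minimalVectors_formTF_iff hm).2 (Or.inr ⟨w, Or.inl rfl, hx, Or.inl ⟨ht, hs⟩⟩)
    refine ⟨h1, fun h => ?_⟩
    have := ((mem_common_minimalVectors_iff hm).1 ⟨h, h1⟩).2.2
    rw [ht, hs] at this
    have hK' : (4 : ℤ) ≤ evenPart m := by exact_mod_cast hK
    nlinarith
  have hK2 := evenPart_cast m
  -- In both parities there is a vector with t = 0 and s = -K; since K ≥ 4, s² exceeds 4 and it is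
  -- not a common minimal vector.
  rcases Nat.even_or_odd m with h | h
  · have hKm := evenPart_of_even h
    refine ⟨ofFrame (fun _ => -1) ((m / 2 : ℕ) : ℤ), hmem _ ?_ ?_ ?_⟩
    · rw [frameCoord_ofFrame]; exact fun i => Or.inr rfl
    · rw [frameLast_ofFrame]; simp; omega
    · rw [frameCoord_ofFrame]; simp; omega
  · have hKm := evenPart_of_odd h
    refine ⟨ofFrame (fun i => (Pi.single ⟨0, by omega⟩ 1 : Fin m → ℤ) i - 1) ((m / 2 : ℕ) : ℤ),
      hmem _ ?_ ?_ ?_⟩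
    · rw [frameCoord_ofFrame]
      intro i
      simp only [Pi.single_apply]
      split_ifs <;> simp
    · rw [frameLast_ofFrame]; simp; omega
    · rw [frameCoord_ofFrame]; simp; omega

end CommonWall

theorem mainTheorem2 :
    (∀ n : ℕ, 4 < n →
      -- `TW(n)` is the codimension-one `L`-cone of the repartitioning complex
      coneDim (tameWall n) + 1 = n * (n + 1) / 2 ∧
      intrinsicInterior ℝ (tameWall n : Set (Matrix (Fin n) (Fin n) ℝ)) =
        {f | f.PosDef ∧ IsDelaunayCell f (repartitioningComplex n)} ∧
      -- `TFₙ` is a perfect form with arithmetic minimum `1`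
      IsPerfectForm (formTF n) ∧
      IsArithmeticMinimum (formTF n) 1 ∧
      -- `TW(n)` is a common wall of a domain of type `Dₙ` and of the domain of `TFₙ`
      (∃ g : Matrix (Fin n) (Fin n) ℝ, IntegrallyEquivalent g (formD n) ∧ IsPerfectForm g ∧
        IsCommonWall (tameWall n) (perfectDomain g) (perfectDomain (formTF n))) ∧
      -- the number of minimal vectors
      (Even n → (minimalVectors (formTF n)).ncard = n * (n + 3)) ∧
      (Odd n → (minimalVectors (formTF n)).ncard = n * (n + 1))) ∧
    IntegrallyEquivalent (formTF 5) formPhi25 ∧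
    IntegrallyEquivalent (formTF 6) formE6Star := by
  refine ⟨fun n hn => ?_, formTF_five_equivalent, formTF_six_equivalent⟩
  obtain ⟨m, rfl⟩ : ∃ m, n = m + 1 := ⟨n - 1, by omega⟩
  have hm : 4 ≤ m := by omega
  obtain ⟨hTF, hD, hwall⟩ := isCommonWall_of_common_minimalVectors (formTF_posDef hm)
    (frameForm_posDef m) (isArithmeticMinimum_formTF hm) (isArithmeticMinimum_frameForm hm)
    (by rw [← tameWall_eq_voronoiCone hm]; exact coneDim_tameWall)
    (exists_mem_minimalVectors_formTF_notMem hm) (exists_mem_minimalVectors_frameForm_notMem hm)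
  refine ⟨coneDim_tameWall, intrinsicInterior_tameWall hm, hTF, isArithmeticMinimum_formTF hm,
    ⟨frameForm m, frameForm_equivalent hm, hD, ?_⟩, fun h => ?_, fun h => ?_⟩
  · rw [tameWall_eq_voronoiCone hm]; exact hwall
  · exact ncard_minimalVectors_formTF_of_odd hm (by
      rwa [Nat.even_add_one, Nat.not_even_iff_odd] at h)
  · exact ncard_minimalVectors_formTF_of_even hm (by
      rwa [Nat.odd_add_one, Nat.not_odd_iff_even] at h)
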